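/- Let $\omega>0$, let $H$ be a complex Hilbert space, and write $L^2=L^2([0,\omega],H)$. Let $W_2^1$ be the space of (absolutely) continuous functions $y:[0,\omega]\to H$ with derivative $y'\in L^2$. Let $\mathcal V:[0,\omega]\to B(H)$ be strongly measurable with $\mathcal V(\cdot)x\in L^2$ for every $x\in H$, and let $\widehat{\mathcal V}(n)\in B(H)$, $n\in\mathbb Z$, be given by $\widehat{\mathcal V}(n)x=\frac1\omega\int_0^\omega e^{-2\pi i n s/\omega}\,\mathcal V(s)x\,ds$. Assume that $$\sum_{n\in\mathbb Z}\|\widehat{\mathcal V}(n)\|^2<\infty \qquad\text{and}\qquad \sum_{j,\ell\in\mathbb Z}\Bigl\|\sum_{n\ne \ell}\frac{\widehat{\mathcal V}(j+n)\widehat{\mathcal V}(\ell+n)}{\ell-n}\Bigr\|^2<\infty .$$ Let $L:D(L)\subset L^2\to L^2$ be the operator $$(Ly)(s)=y'(s)-\mathcal V(s)y(\omega-s),\qquad D(L)=\{y\in W_2^1:\ y(0)=y(\omega)\}.$$ **Theorem 2.2.** The operator $L$ is the infinitesimal generator of a unique strongly continuous operator group $T:\mathbb R\to B(L^2)$. Moreover,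 let $\mathcal J$ be one of the intervals $(-\infty,\infty)$, $(-\infty,\beta]$, $[\alpha,\beta]$, $[\alpha,\infty)$, with $0\in\mathcal J$, let $\varphi\in L^2$, and let $\widetilde f:\mathcal J\to L^2$ be continuous. Then the problem $$\widetilde u_t=L\widetilde u+\widetilde f,\qquad \widetilde u(0)=\varphi,$$ has exactly one mild solution on $\mathcal J$, that is, exactly one continuous function $\widetilde u:\mathcal J\to L^2$ such that, for all $t\in\mathcal J$, $\int_0^t\widetilde u(s)\,ds\in D(L)$ and $$\widetilde u(t)=\varphi+L\int_0^t\widetilde u(s)\,ds+\int_0^t\widetilde f(s)\,ds ,$$ and this solution is given by $$\widetilde u(t)=T(t)\varphi+\int_0^tT(t-\tau)\widetilde f(\tau)\,d\tau,\qquad t\in\mathcal J .$$ -/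

import Mathlib

open MeasureTheory Set Filter Topology
open scoped ENNReal

noncomputable section

namespace InvolutionProblem

set_option linter.unusedSectionVars false

section Spaces

variable {H : Type*} [NormedAddCommGroup H] [InnerProductSpace ℂ H]

/-- The space `L²([0, ω], H)`. -/
abbrev L2 (ω : ℝ) (H : Type*) [NormedAddCommGroup H] : Type _ :=
  Lp H 2 (volume.restrict (Icc (0 : ℝ) ω))

/-- `Y : [0, ω] → H` is the (absolutely) continuous representative of `y ∈ W₂¹([0, ω], H)` and
`g ∈ L²` is the derivative of `y`. Only the values of `Y` on `[0, ω]` matter. -/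
def IsSobolevRep (ω : ℝ) (y : L2 ω H) (Y : ℝ → H) (g : L2 ω H) : Prop :=
  (y =ᵐ[volume.restrict (Icc (0 : ℝ) ω)] Y) ∧
    ∀ s ∈ Icc (0 : ℝ) ω, Y s = Y 0 + ∫ r in (0 : ℝ)..s, g r

variable {ω : ℝ}

lemma L2.integrable (g : L2 ω H) : Integrable g (volume.restrict (Icc (0 : ℝ) ω)) :=
  (Lp.memLp g).integrable (by norm_num)

lemma L2.intervalIntegrable (g : L2 ω H) {s : ℝ} (hs : s ∈ Icc (0 : ℝ) ω) :
    IntervalIntegrable g volume 0 s := by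
  rw [intervalIntegrable_iff_integrableOn_Ioc_of_le hs.1]
  exact IntegrableOn.mono_set (L2.integrable g)
    (fun r hr => ⟨hr.1.le, hr.2.trans hs.2⟩)

lemma intervalIntegral_congr_L2 {f g : ℝ → H}
    (h : f =ᵐ[volume.restrict (Icc (0 : ℝ) ω)] g) {s : ℝ} (hs : s ∈ Icc (0 : ℝ) ω) :
    ∫ r in (0 : ℝ)..s, f r = ∫ r in (0 : ℝ)..s, g r := by
  rw [intervalIntegral.integral_of_le hs.1, intervalIntegral.integral_of_le hs.1]
  exact integral_congr_ae (ae_restrict_of_ae_restrict_of_subset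
    (show Ioc 0 s ⊆ Icc 0 ω from fun r hr => ⟨hr.1.le, hr.2.trans hs.2⟩) h)

lemma IsSobolevRep.zero : IsSobolevRep ω (0 : L2 ω H) 0 0 := by
  refine ⟨Lp.coeFn_zero _ _ _, fun s hs => ?_⟩
  rw [intervalIntegral_congr_L2 (Lp.coeFn_zero _ _ _) hs]
  simp

lemma IsSobolevRep.add {y y' g g' : L2 ω H} {Y Y' : ℝ → H} (h : IsSobolevRep ω y Y g)
    (h' : IsSobolevRep ω y' Y' g') : IsSobolevRep ω (y + y') (Y + Y') (g + g') := by
  refine ⟨(Lp.coeFn_add y y').trans (h.1.add h'.1), fun s hs => ?_⟩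
  rw [intervalIntegral_congr_L2 (Lp.coeFn_add g g') hs]
  simp only [Pi.add_apply]
  rw [intervalIntegral.integral_add (g.intervalIntegrable hs) (g'.intervalIntegrable hs),
    h.2 s hs, h'.2 s hs]
  abel

lemma IsSobolevRep.smul {y g : L2 ω H} {Y : ℝ → H} (c : ℂ) (h : IsSobolevRep ω y Y g) :
    IsSobolevRep ω (c • y) (c • Y) (c • g) := by
  refine ⟨(Lp.coeFn_smul c y).trans (h.1.const_smul c), fun s hs => ?_⟩
  rw [intervalIntegral_congr_L2 (Lp.coeFn_smul c g) hs]
  simp only [Pi.smul_apply]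
  rw [intervalIntegral.integral_smul, h.2 s hs, smul_add]

/-- The domain `{y ∈ W₂¹([0, ω], H) : y(0) = y(ω)}`. -/
def periodicDomain (ω : ℝ) (H : Type*) [NormedAddCommGroup H] [InnerProductSpace ℂ H] :
    Submodule ℂ (L2 ω H) where
  carrier := {y | ∃ (Y : ℝ → H) (g : L2 ω H), IsSobolevRep ω y Y g ∧ Y 0 = Y ω}
  zero_mem' := ⟨0, 0, IsSobolevRep.zero, rfl⟩
  add_mem' := by
    rintro y y' ⟨Y, g, h, hY⟩ ⟨Y', g', h', hY'⟩
    exact ⟨_, _, h.add h', by simp [hY, hY']⟩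
  smul_mem' := by
    rintro c y ⟨Y, g, h, hY⟩
    exact ⟨_, _, h.smul c, by simp [hY]⟩

/-- The graph of the operator `(Ly)(s) = y'(s) - V(s) y(ω - s)` with periodic boundary
conditions. -/
def operatorGraph (ω : ℝ) (V : ℝ → H →L[ℂ] H) : Submodule ℂ (L2 ω H × L2 ω H) where
  carrier := {p | ∃ (Y : ℝ → H) (g : L2 ω H), IsSobolevRep ω p.1 Y g ∧ Y 0 = Y ω ∧
    p.2 =ᵐ[volume.restrict (Icc (0 : ℝ) ω)] fun s => g s - V s (Y (ω - s))}
  zero_mem' := by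
    refine ⟨0, 0, IsSobolevRep.zero, rfl, ?_⟩
    filter_upwards with s
    simp
  add_mem' := by
    rintro ⟨y, z⟩ ⟨y', z'⟩ ⟨Y, g, h, hY, hz⟩ ⟨Y', g', h', hY', hz'⟩
    refine ⟨_, _, h.add h', by simp [hY, hY'], ?_⟩
    filter_upwards [hz, hz', Lp.coeFn_add z z', Lp.coeFn_add g g'] with s h1 h2 h3 h4
    simp only [Prod.mk_add_mk] at *
    rw [h3, h4]
    simp only [Pi.add_apply, h1, h2, map_add]
    abel
  smul_mem' := by
    rintro c ⟨y, z⟩ ⟨Y, g, h, hY, hz⟩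
    refine ⟨_, _, h.smul c, by simp [hY], ?_⟩
    filter_upwards [hz, Lp.coeFn_smul c z, Lp.coeFn_smul c g] with s h1 h3 h4
    simp only [Prod.smul_mk] at *
    rw [h3, h4]
    simp only [Pi.smul_apply, h1, map_smul, smul_sub]

/-- The unbounded operator `L` on `L²([0, ω], H)`, `(Ly)(s) = y'(s) - V(s) y(ω - s)`, with domain
`{y ∈ W₂¹ : y(0) = y(ω)}` (see `graph_operatorL` and `domain_operatorL` below). -/
def operatorL (ω : ℝ) (V : ℝ → H →L[ℂ] H) : L2 ω H →ₗ.[ℂ] L2 ω H :=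
  (operatorGraph ω V).toLinearPMap

/-- `V` is strongly measurable and `s ↦ V(s) x` belongs to `L²([0, ω], H)` for every `x ∈ H`. -/
def IsStronglyL2 (ω : ℝ) (V : ℝ → H →L[ℂ] H) : Prop :=
  ∀ x : H, MemLp (fun s => V s x) 2 (volume.restrict (Icc (0 : ℝ) ω))

end Spaces

section Facts

variable {H : Type*} [NormedAddCommGroup H] [InnerProductSpace ℂ H] [CompleteSpace H] {ω : ℝ}

lemma IsSobolevRep.continuousOn (hω : 0 < ω) {y g : L2 ω H} {Y : ℝ → H}
    (h : IsSobolevRep ω y Y g) : ContinuousOn Y (Icc 0 ω) := by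
  have h1 : ContinuousOn (fun s => Y 0 + ∫ r in (0 : ℝ)..s, g r) (Icc 0 ω) := by
    refine continuousOn_const.add ((intervalIntegral.continuousOn_primitive_interval (b := ω)
      ?_).mono Icc_subset_uIcc)
    rw [uIcc_of_le hω.le]
    exact L2.integrable g
  exact h1.congr h.2

lemma IsSobolevRep.eq_zero (hω : 0 < ω) {g : L2 ω H} {Y : ℝ → H} (h : IsSobolevRep ω 0 Y g) :
    EqOn Y 0 (Icc 0 ω) ∧ g = 0 := by
  have hY : EqOn Y 0 (Icc 0 ω) :=
    Measure.eqOn_Icc_of_ae_eq volume hω.ne (h.1.symm.trans (Lp.coeFn_zero _ _ _))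
      (h.continuousOn hω) continuousOn_const
  refine ⟨hY, ?_⟩
  have h0 : (0 : ℝ) ∈ Icc (0 : ℝ) ω := ⟨le_rfl, hω.le⟩
  have hI : ∀ s ∈ Icc (0 : ℝ) ω, ∫ r in (0 : ℝ)..s, g r = 0 := by
    intro s hs
    have := h.2 s hs
    rw [hY hs, hY h0] at this
    simpa using this.symm
  apply Lp.ext
  refine EventuallyEq.trans ?_ (Lp.coeFn_zero _ _ _).symm
  have hae := (g.intervalIntegrable (right_mem_Icc.2 hω.le)).ae_hasDerivAt_integral
  have hne : ∀ c : ℝ, ∀ᵐ x : ℝ, x ≠ c := fun c => by simp [ae_iff, measure_singleton]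
  change ∀ᵐ s ∂(volume.restrict (Icc (0 : ℝ) ω)), g s = 0
  rw [ae_restrict_iff' measurableSet_Icc]
  filter_upwards [hae, hne 0, hne ω] with s hs h1 h2 hmem
  rw [uIcc_of_le hω.le] at hs
  have hd := hs hmem 0 h0
  have hd0 : HasDerivAt (fun x => ∫ t in (0 : ℝ)..x, g t) 0 s := by
    refine (hasDerivAt_const s (0 : H)).congr_of_eventuallyEq ?_
    filter_upwards [Icc_mem_nhds (lt_of_le_of_ne hmem.1 h1.symm) (lt_of_le_of_ne hmem.2 h2)]
      with x hx using hI x hx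
  exact hd.unique hd0

theorem graph_operatorL (hω : 0 < ω) (V : ℝ → H →L[ℂ] H) :
    (operatorL ω V).graph = operatorGraph ω V := by
  apply Submodule.toLinearPMap_graph_eq
  rintro ⟨y, z⟩ ⟨Y, g, h, hY, hz⟩ hy
  simp only at h hz hy ⊢
  subst hy
  obtain ⟨h1, rfl⟩ := h.eq_zero hω
  apply Lp.ext
  filter_upwards [hz, Lp.coeFn_zero H 2 (volume.restrict (Icc (0 : ℝ) ω)),
    ae_restrict_mem measurableSet_Icc] with s h2 h3 hs
  rw [h2, h3, h1 (show ω - s ∈ Icc 0 ω from ⟨by linarith [hs.2], by linarith [hs.1]⟩)]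
  simp

/-- `x ↦ V(·)x` as a bounded operator from `H` to `L²([0, ω], H)`. -/
def potentialMap {V : ℝ → H →L[ℂ] H} (hV : IsStronglyL2 ω V) : H →L[ℂ] L2 ω H :=
  ContinuousLinearMap.ofSeqClosedGraph
    (g := { toFun := fun x => (hV x).toLp _
            map_add' := fun x y => by
              rw [← MemLp.toLp_add]
              exact MemLp.toLp_congr _ _ (.of_forall fun s => by simp)
            map_smul' := fun c x => by
              rw [RingHom.id_apply, ← MemLp.toLp_const_smul]
              exact MemLp.toLp_congr _ _ (.of_forall fun s => by simp) })
    (by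
      intro u x z hu hz
      simp only [LinearMap.coe_mk, AddHom.coe_mk, Function.comp_def] at hz ⊢
      obtain ⟨k, hk, hae⟩ := (tendstoInMeasure_of_tendsto_Lp hz).exists_seq_tendsto_ae
      have h1 : ∀ᵐ s ∂(volume.restrict (Icc (0 : ℝ) ω)), ∀ n, (hV (u n)).toLp _ s = V s (u n) :=
        ae_all_iff.2 fun n => (hV (u n)).coeFn_toLp
      apply Lp.ext
      filter_upwards [hae, h1, (hV x).coeFn_toLp] with s h2 h3 h4
      rw [h4]
      simp only [h3] at h2
      exact tendsto_nhds_unique h2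
        (((V s).continuous.tendsto x).comp (hu.comp hk.tendsto_atTop)))

lemma aestronglyMeasurable_apply {α : Type*} [MeasurableSpace α] {ν : Measure α}
    {A : α → H →L[ℂ] H} (hA : ∀ x, AEStronglyMeasurable (fun a => A a x) ν) {Z : α → H}
    (hZ : AEStronglyMeasurable Z ν) : AEStronglyMeasurable (fun a => A a (Z a)) ν := by
  obtain ⟨Z0, hZ0, hae⟩ := hZ
  suffices h : AEStronglyMeasurable (fun a => A a (Z0 a)) ν by
    refine h.congr ?_
    filter_upwards [hae] with a ha
    rw [ha]
  have hs : ∀ f : SimpleFunc α H, AEStronglyMeasurable (fun a => A a (f a)) ν := by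
    intro f
    induction f using SimpleFunc.induction with
    | @const c t hs =>
      refine ((hA c).indicator hs).congr (.of_forall fun a => ?_)
      by_cases ha : a ∈ t
      · simp [indicator, ha]
      · simp [indicator, ha]
    | add _ hf hg =>
      refine (hf.add hg).congr (.of_forall fun a => ?_)
      simp
  exact aestronglyMeasurable_of_tendsto_ae atTop (fun n => hs (hZ0.approx n))
    (.of_forall fun a => ((A a).continuous.tendsto _).comp (hZ0.tendsto_approx a))

lemma memLp_potential (hω : 0 < ω) {V : ℝ → H →L[ℂ] H} (hV : IsStronglyL2 ω V) {y g : L2 ω H}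
    {Y : ℝ → H} (h : IsSobolevRep ω y Y g) :
    MemLp (fun s => V s (Y (ω - s))) 2 (volume.restrict (Icc (0 : ℝ) ω)) := by
  set μ := volume.restrict (Icc (0 : ℝ) ω) with hμ
  have hmaps : MapsTo (fun s => ω - s) (Icc (0 : ℝ) ω) (Icc 0 ω) :=
    fun s hs => ⟨by linarith [hs.2], by linarith [hs.1]⟩
  have hZ : AEStronglyMeasurable (fun s => Y (ω - s)) μ :=
    ((h.continuousOn hω).comp (by fun_prop) hmaps).aestronglyMeasurable measurableSet_Icc
  have hm := aestronglyMeasurable_apply (fun x => (hV x).1) hZ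
  suffices hW : MemLp (fun s => V s (Y (ω - s)) - V s (Y 0)) 2 μ by
    refine (hW.add (hV (Y 0))).congr_norm hm (.of_forall fun s => ?_)
    simp
  refine ⟨hm.sub (hV (Y 0)).1, ?_⟩
  rw [eLpNorm_lt_top_iff_lintegral_rpow_enorm_lt_top (by norm_num) (by norm_num)]
  simp only [ENNReal.toReal_ofNat, ENNReal.rpow_ofNat]
  have hsq : ∀ {β : Type} [MeasurableSpace β] (ν : Measure β) (f : β → H),
      ∫⁻ b, ‖f b‖ₑ ^ 2 ∂ν = eLpNorm f 2 ν ^ 2 := by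
    intro β _ ν f
    have := eLpNorm_nnreal_pow_eq_lintegral (f := f) (μ := ν) (p := 2) (by norm_num)
    simpa using this.symm
  set C := ‖potentialMap hV‖ₑ
  have hC : ∀ x, ∫⁻ s, ‖V s x‖ₑ ^ 2 ∂μ ≤ (C * ‖x‖ₑ) ^ 2 := by
    intro x
    rw [hsq]
    gcongr
    have h1 : eLpNorm (fun s => V s x) 2 μ = ‖potentialMap hV x‖ₑ :=
      (Lp.enorm_toLp (hV x)).symm
    rw [h1]
    exact (potentialMap hV).le_opENorm x
  have hpt : ∀ s ∈ Icc (0 : ℝ) ω,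
      ‖V s (Y (ω - s)) - V s (Y 0)‖ₑ ^ 2 ≤ (∫⁻ r, ‖V s (g r)‖ₑ ^ 2 ∂μ) * μ univ := by
    intro s hs
    have h1 : V s (Y (ω - s)) - V s (Y 0) = ∫ r in (0 : ℝ)..(ω - s), V s (g r) := by
      rw [h.2 _ (hmaps hs), map_add, add_sub_cancel_left,
        (V s).intervalIntegral_comp_comm (g.intervalIntegrable (hmaps hs))]
    have h2 : ‖V s (Y (ω - s)) - V s (Y 0)‖ₑ ≤ eLpNorm (fun r => V s (g r)) 1 μ := by
      rw [h1, intervalIntegral.integral_of_le (hmaps hs).1, eLpNorm_one_eq_lintegral_enorm]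
      exact (enorm_integral_le_lintegral_enorm _).trans
        (lintegral_mono_set fun r hr => ⟨hr.1.le, hr.2.trans (hmaps hs).2⟩)
    have h3 := eLpNorm_le_eLpNorm_mul_rpow_measure_univ (p := 1) (q := 2) (by norm_num)
      ((V s).continuous.comp_aestronglyMeasurable (Lp.aestronglyMeasurable g))
    rw [hsq]
    calc _ ≤ (eLpNorm (fun r => V s (g r)) 2 μ *
              μ univ ^ (1 / (1 : ℝ≥0∞).toReal - 1 / (2 : ℝ≥0∞).toReal)) ^ 2 := by
            gcongr
            exact h2.trans h3
      _ = _ := by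
            rw [mul_pow, ← ENNReal.rpow_natCast (μ univ ^ _), ← ENNReal.rpow_mul]
            norm_num
  have hfin : μ univ ≠ ∞ := measure_ne_top μ univ
  calc ∫⁻ s, ‖V s (Y (ω - s)) - V s (Y 0)‖ₑ ^ 2 ∂μ
      ≤ ∫⁻ s, (∫⁻ r, ‖V s (g r)‖ₑ ^ 2 ∂μ) * μ univ ∂μ := by
        refine lintegral_mono_ae ?_
        filter_upwards [ae_restrict_mem measurableSet_Icc] with s hs using hpt s hs
    _ = (∫⁻ s, ∫⁻ r, ‖V s (g r)‖ₑ ^ 2 ∂μ ∂μ) * μ univ := lintegral_mul_const' _ _ hfin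
    _ = (∫⁻ r, ∫⁻ s, ‖V s (g r)‖ₑ ^ 2 ∂μ ∂μ) * μ univ := by
        rw [lintegral_lintegral_swap]
        exact ((aestronglyMeasurable_apply (ν := μ.prod μ) (A := fun p => V p.1)
          (Z := fun p => g p.2) (fun x => (hV x).1.comp_fst)
          (Lp.aestronglyMeasurable g).comp_snd).enorm.pow_const 2)
    _ ≤ (∫⁻ r, C ^ 2 * ‖g r‖ₑ ^ 2 ∂μ) * μ univ := by
        gcongr with r
        exact (hC _).trans_eq (mul_pow _ _ _)
    _ = C ^ 2 * eLpNorm g 2 μ ^ 2 * μ univ := by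
        rw [lintegral_const_mul' _ _ (by finiteness), hsq]
    _ < ∞ := by
        have := (Lp.memLp g).2
        finiteness

/-- `L` is defined on all periodic functions in `W₂¹([0, ω], H)`, and on nothing else. -/
theorem domain_operatorL (hω : 0 < ω) {V : ℝ → H →L[ℂ] H} (hV : IsStronglyL2 ω V) :
    (operatorL ω V).domain = periodicDomain ω H := by
  ext y
  rw [operatorL, Submodule.toLinearPMap_domain, Submodule.mem_map]
  constructor
  · rintro ⟨p, ⟨Y, g, h, hY, -⟩, rfl⟩
    exact ⟨Y, g, h, hY⟩
  · rintro ⟨Y, g, h, hY⟩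
    refine ⟨(y, g - (memLp_potential hω hV h).toLp _), ⟨Y, g, h, hY, ?_⟩, rfl⟩
    filter_upwards [Lp.coeFn_sub g ((memLp_potential hω hV h).toLp _),
      (memLp_potential hω hV h).coeFn_toLp] with s h1 h2
    rw [h1, Pi.sub_apply, h2]

/-- The character `s ↦ e^{-2πins/ω}`. -/
def expNeg (ω : ℝ) (n : ℤ) (s : ℝ) : ℂ :=
  Complex.exp (-(2 * Real.pi * n * s / ω : ℝ) * Complex.I)

lemma norm_expNeg (ω : ℝ) (n : ℤ) (s : ℝ) : ‖expNeg ω n s‖ = 1 := by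
  rw [expNeg, ← Complex.ofReal_neg, Complex.norm_exp_ofReal_mul_I]

lemma integrable_expNeg_smul {f : ℝ → H} (hf : MemLp f 2 (volume.restrict (Icc (0 : ℝ) ω)))
    (n : ℤ) : Integrable (fun s => expNeg ω n s • f s) (volume.restrict (Icc (0 : ℝ) ω)) := by
  refine (hf.integrable (by norm_num)).bdd_smul (C := 1) ?_ (Eventually.of_forall fun s => ?_)
  · have : Continuous (expNeg ω n) := by unfold expNeg; fun_prop
    exact this.aestronglyMeasurable
  · exact (norm_expNeg ω n s).le

/-- The Fourier coefficient `x ↦ (1/ω) ∫₀^ω e^{-2πins/ω} V(s) x ds`, an element of `B(H)`. -/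
def fourierCoeffV {V : ℝ → H →L[ℂ] H} (hV : IsStronglyL2 ω V) (n : ℤ) : H →L[ℂ] H :=
  ContinuousLinearMap.ofSeqClosedGraph
    (g := { toFun := fun x => (ω : ℂ)⁻¹ • ∫ s in Icc (0 : ℝ) ω, expNeg ω n s • V s x
            map_add' := fun x y => by
              simp only [map_add, smul_add]
              rw [integral_add (integrable_expNeg_smul (hV x) n)
                (integrable_expNeg_smul (hV y) n), smul_add]
            map_smul' := fun c x => by
              simp only [map_smul, RingHom.id_apply, smul_comm _ c]
              rw [integral_smul, smul_comm] })
    (by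
      intro u x z hu hz
      refine tendsto_nhds_unique hz ?_
      simp only [LinearMap.coe_mk, AddHom.coe_mk, Function.comp_def]
      refine Tendsto.const_smul ?_ _
      refine tendsto_integral_of_L1 _ (integrable_expNeg_smul (hV x) n).aestronglyMeasurable
        (.of_forall fun k => integrable_expNeg_smul (hV (u k)) n) ?_
      set K : ℝ≥0∞ := volume.restrict (Icc (0 : ℝ) ω) univ ^
        (1 / (1 : ℝ≥0∞).toReal - 1 / (2 : ℝ≥0∞).toReal)
      have hK : K ≠ ∞ := ENNReal.rpow_ne_top_of_nonneg (by norm_num) (measure_ne_top _ _)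
      have hlim : Tendsto (fun k => ‖potentialMap hV (u k - x)‖ₑ * K) atTop (𝓝 0) := by
        have h1 : Tendsto (fun k => ‖potentialMap hV (u k - x)‖ₑ) atTop (𝓝 0) := by
          have h2 : Tendsto (fun k => u k - x) atTop (𝓝 0) := by
            simpa using hu.sub_const x
          simpa using (((potentialMap hV).continuous.tendsto 0).comp h2).enorm
        simpa using ENNReal.Tendsto.mul_const h1 (Or.inr hK)
      refine tendsto_of_tendsto_of_tendsto_of_le_of_le tendsto_const_nhds hlim
        (fun _ => bot_le) fun k => ?_
      have h3 := eLpNorm_le_eLpNorm_mul_rpow_measure_univ (p := 1) (q := 2) (by norm_num)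
        (hV (u k - x)).1
      have h4 : eLpNorm (fun s => V s (u k - x)) 2 (volume.restrict (Icc (0 : ℝ) ω)) =
          ‖potentialMap hV (u k - x)‖ₑ := (Lp.enorm_toLp (hV (u k - x))).symm
      rw [h4, eLpNorm_one_eq_lintegral_enorm] at h3
      refine le_trans (le_of_eq (lintegral_congr fun s => ?_)) h3
      rw [← smul_sub, ← map_sub, enorm_smul, ← ofReal_norm, norm_expNeg]
      simp)

/-- The condition `∑ₙ ‖V̂(n)‖² < ∞`. -/
def SquareSummableCoeff {V : ℝ → H →L[ℂ] H} (hV : IsStronglyL2 ω V) : Prop :=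
  Summable fun n : ℤ => ‖fourierCoeffV hV n‖ ^ 2

/-- The condition `∑_{j,ℓ} ‖∑_{n ≠ ℓ} V̂(j+n) V̂(ℓ+n) / (ℓ-n)‖² < ∞`. The inner series converges
absolutely in `B(H)` as soon as `∑ₙ ‖V̂(n)‖² < ∞`. -/
def SquareSummableHankel {V : ℝ → H →L[ℂ] H} (hV : IsStronglyL2 ω V) : Prop :=
  Summable fun p : ℤ × ℤ =>
    ‖∑' n : {n : ℤ // n ≠ p.2}, ((p.2 : ℂ) - ((n : ℤ) : ℂ))⁻¹ •
      (fourierCoeffV hV (p.1 + n) ∘L fourierCoeffV hV (p.2 + n))‖ ^ 2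

end Facts

section Abstract

variable {X : Type*} [NormedAddCommGroup X] [NormedSpace ℂ X]

/-- `T : ℝ → B(X)` is a strongly continuous operator group. -/
structure IsC0Group (T : ℝ → X →L[ℂ] X) : Prop where
  map_zero : T 0 = 1
  map_add : ∀ s t, T (s + t) = T s * T t
  continuous : ∀ x, Continuous fun t => T t x

/-- `A` is the infinitesimal generator of `T`: `x ∈ D(A)` and `Ax = y` if and only if
`(T(h)x - x)/h → y` as `h → 0`. -/
def IsGenerator (A : X →ₗ.[ℂ] X) (T : ℝ → X →L[ℂ] X) : Prop :=
  ∀ x y, (x, y) ∈ A.graph ↔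
    Tendsto (fun h : ℝ => (h : ℂ)⁻¹ • (T h x - x)) (𝓝[≠] 0) (𝓝 y)

/-- `u` is a mild solution on `J` of `u' = Au + f`, `u(0) = φ`. Only the values of `u` and `f` on
`J` matter. -/
structure IsMildSolution [NormedSpace ℝ X] (A : X →ₗ.[ℂ] X) (J : Set ℝ) (φ : X) (f u : ℝ → X) :
    Prop where
  continuousOn : ContinuousOn u J
  mem_domain : ∀ t ∈ J, ∫ τ in (0 : ℝ)..t, u τ ∈ A.domain
  eq : ∀ (t : ℝ) (ht : t ∈ J),
    u t = φ + A ⟨∫ τ in (0 : ℝ)..t, u τ, mem_domain t ht⟩ + ∫ τ in (0 : ℝ)..t, f τ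

end Abstract

/-- `J` is one of the intervals `(-∞, ∞)`, `(-∞, β]`, `[α, β]`, `[α, ∞)`. -/
def IsTimeInterval (J : Set ℝ) : Prop :=
  J = univ ∨ (∃ β, J = Iic β) ∨ (∃ α β, J = Icc α β) ∨ ∃ α, J = Ici α

end InvolutionProblem

/-! The operator is similar to a bounded perturbation of a diagonal operator. Put `b = 2π/ω`, let
`A` be the diagonal operator on `ℓ²(ℤ, H)` with eigenvalues `ibn`, and let `B` be the Hankel
operator with entries `v (j + n)`, where `v n` is the Fourier coefficient `V̂(n)`. The reflection `s
↦ ω - s` turns each character into its conjugate, so the Fourier transform carries `L` to `A - B`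
(`mem_operatorGraph_iff`). In general `B` is unbounded, so the perturbation theorem for bounded
operators does not apply to `A - B` itself.

The remedy is to solve `AΓ - ΓA = B - R`. Away from the diagonal the entries of `Γ` are `v (j + n) /
(ib(j - n))`; on the diagonal and on a finite set `F` they are zero, and `R` collects the entries of
`B` left over there. The first hypothesis makes `Γ` and `R` square summable, hence bounded; the
second makes `K = BΓ` square summable (`isHS_hankelProd`). With `P = 1 + Γ`, on the domain of `A`,
`(A - B)P = A + ΓA + B - R - B - BΓ = P(A - P⁻¹(R + K))`. Taking `F` large gives `‖Γ‖ < 1`, so `P`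
is invertible. It must also map the domain of `A` onto itself, in both directions; this follows from
the invertibility of `1 + Γ'`, where `Γ' = (A - 1)Γ(A - 1)⁻¹` is again square summable and has norm
below one for large `F`.

Now `A` generates a group of isometries, a bounded perturbation of it generates a group
(`exists_perturbedGroup`), and conjugation by `P` and by the Fourier transform yields the group of
`L` (`exists_modelGroup`, `exists_group_operatorL`). Existence, uniqueness and the Duhamel formula
for mild solutions hold for every strongly continuous group on a Banach space
(`IsGenerator.existsUnique_mild`); uniqueness of the group is the homogeneous case. -/

namespace InvolutionProblem

set_option linter.unusedSectionVars false

/-! ### Strongly continuous groups and mild solutions. -/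

section AbstractGroups

variable {X : Type*} [NormedAddCommGroup X] [NormedSpace ℂ X] [NormedSpace ℝ X]
  [IsScalarTower ℝ ℂ X]

/-- `y` is the derivative at `0` of the orbit `t ↦ T t x`. -/
def HasOrbitDeriv (T : ℝ → X →L[ℂ] X) (x y : X) : Prop :=
  Tendsto (fun h : ℝ => (h : ℂ)⁻¹ • (T h x - x)) (𝓝[≠] 0) (𝓝 y)

/-- A strongly continuous family of operators on a Banach space is jointly continuous. -/
lemma continuous_uncurry_of_strong [CompleteSpace X] {K : ℝ → X →L[ℂ] X}
    (hK : ∀ x, Continuous fun t => K t x) : Continuous fun p : ℝ × X => K p.1 p.2 := by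
  rw [continuous_iff_continuousAt]
  rintro ⟨t, x⟩
  obtain ⟨C, hC⟩ : ∃ C, ∀ i : Icc (t - 1) (t + 1), ‖K i‖ ≤ C := by
    apply banach_steinhaus
    intro z
    obtain ⟨C, hC⟩ := (isCompact_Icc (a := t - 1) (b := t + 1)).exists_bound_of_continuousOn
      (hK z).continuousOn
    exact ⟨C, fun i => hC i i.2⟩
  have h1 : Tendsto (fun p : ℝ × X => C * ‖p.2 - x‖ + ‖K p.1 x - K t x‖) (𝓝 (t, x)) (𝓝 0) := by
    have h2 : Continuous fun p : ℝ × X => C * ‖p.2 - x‖ + ‖K p.1 x - K t x‖ := by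
      have := (hK x).comp (continuous_fst (X := ℝ) (Y := X))
      simp only [Function.comp_def] at this
      fun_prop
    simpa using h2.tendsto (t, x)
  rw [ContinuousAt, tendsto_iff_norm_sub_tendsto_zero]
  refine tendsto_of_tendsto_of_tendsto_of_le_of_le' tendsto_const_nhds h1
    (.of_forall fun _ => norm_nonneg _) ?_
  have h3 : ∀ᶠ p : ℝ × X in 𝓝 (t, x), p.1 ∈ Icc (t - 1) (t + 1) :=
    continuous_fst.continuousAt.eventually
      (Icc_mem_nhds (show t - 1 < t by linarith) (show t < t + 1 by linarith))
  filter_upwards [h3] with p hp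
  calc ‖K p.1 p.2 - K t x‖ = ‖K p.1 (p.2 - x) + (K p.1 x - K t x)‖ := by
        rw [map_sub]; congr 1; abel
    _ ≤ ‖K p.1 (p.2 - x)‖ + ‖K p.1 x - K t x‖ := norm_add_le _ _
    _ ≤ _ := by
        gcongr
        exact (K p.1).le_of_opNorm_le (hC ⟨p.1, hp⟩) _

/-- Product rule for a strongly continuous family of operators applied to a curve. -/
lemma HasDerivAt.strong_apply [CompleteSpace X] {K : ℝ → X →L[ℂ] X}
    (hK : ∀ x, Continuous fun t => K t x) {w : ℝ → X} {w' k' : X} {s : ℝ}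
    (hw : HasDerivAt w w' s) (hk : HasDerivAt (fun t => K t (w s)) k' s) :
    HasDerivAt (fun t => K t (w t)) (k' + K s w') s := by
  rw [hasDerivAt_iff_tendsto_slope] at hw hk ⊢
  have hj := continuous_uncurry_of_strong hK
  -- `K` is not differentiable in norm, so the difference quotient is split into that of `K t (w s)`
  -- and `K t` applied to the slope of `w`. Joint continuity handles the second.
  have h1 : Tendsto (fun t => K t (slope w s t)) (𝓝[≠] s) (𝓝 (K s w')) := by
    have h2 : Tendsto (fun t : ℝ => (t, slope w s t)) (𝓝[≠] s) (𝓝 (s, w')) :=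
      (tendsto_id.mono_left nhdsWithin_le_nhds).prodMk_nhds hw
    exact (hj.tendsto (s, w')).comp h2
  refine (hk.add h1).congr fun t => ?_
  simp only [slope_def_module]
  rw [(K t).map_smul_of_tower, ← smul_add, map_sub]
  congr 1
  abel

variable {T : ℝ → X →L[ℂ] X}

lemma hasOrbitDeriv_iff (hT : IsC0Group T) {x y : X} :
    HasOrbitDeriv T x y ↔ HasDerivAt (fun t => T t x) y 0 := by
  rw [hasDerivAt_iff_tendsto_slope, HasOrbitDeriv]
  refine tendsto_congr fun h => ?_
  rw [slope_def_module, hT.map_zero, one_apply_eq_self, sub_zero,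
    ← algebraMap_smul ℂ h⁻¹, Complex.coe_algebraMap, Complex.ofReal_inv]

lemma HasOrbitDeriv.hasDerivAt (hT : IsC0Group T) {x y : X} (h : HasOrbitDeriv T x y) (t : ℝ) :
    HasDerivAt (fun t => T t x) (T t y) t := by
  rw [hasOrbitDeriv_iff hT] at h
  have h1 : HasDerivAt (fun s => T (s - t) x) y t := by
    have h2 : HasDerivAt (fun t => T t x) y (t - t) := by rwa [sub_self]
    exact h2.comp_sub_const t t
  have h2 := ((T t).restrictScalars ℝ).hasFDerivAt.comp_hasDerivAt t h1
  refine h2.congr_of_eventuallyEq (.of_forall fun s => ?_)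
  have h3 := hT.map_add t (s - t)
  rw [add_sub_cancel] at h3
  simp [h3]

lemma IsC0Group.apply_apply (hT : IsC0Group T) (s t : ℝ) (x : X) : T s (T t x) = T (s + t) x := by
  rw [hT.map_add]; rfl

lemma IsC0Group.apply_neg_apply (hT : IsC0Group T) (t : ℝ) (x : X) : T t (T (-t) x) = x := by
  rw [hT.apply_apply, add_neg_cancel, hT.map_zero, one_apply_eq_self]

lemma IsC0Group.zero_apply (hT : IsC0Group T) (x : X) : T 0 x = x := by
  rw [hT.map_zero, one_apply_eq_self]

/-- An orbit satisfying the integrated equation is differentiable at `0`. -/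
lemma hasOrbitDeriv_of_integral [CompleteSpace X] (hT : IsC0Group T) {x y : X}
    (h : ∀ r, T r x = x + ∫ σ in (0 : ℝ)..r, T σ y) : HasOrbitDeriv T x y := by
  rw [hasOrbitDeriv_iff hT]
  have h1 := (intervalIntegral.integral_hasDerivAt_right
    ((hT.continuous y).intervalIntegrable 0 0)
    ((hT.continuous y).stronglyMeasurableAtFilter _ _) (hT.continuous y).continuousAt).const_add x
  rw [hT.zero_apply] at h1
  exact h1.congr_of_eventuallyEq (.of_forall h)

lemma HasDerivAt.integral_of_continuous [CompleteSpace X] {f : ℝ → X} (hf : Continuous f) (t : ℝ) :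
    HasDerivAt (fun t => ∫ s in (0 : ℝ)..t, f s) (f t) t :=
  intervalIntegral.integral_hasDerivAt_right (hf.intervalIntegrable _ _)
    (hf.stronglyMeasurableAtFilter _ _) hf.continuousAt

/-- The operator `x ↦ ∫₀ʳ T(σ) x dσ`. -/
lemma IsC0Group.exists_integralCLM [CompleteSpace X] (hT : IsC0Group T) (r : ℝ) :
    ∃ R : X →L[ℂ] X, ∀ x, R x = ∫ σ in (0 : ℝ)..r, T σ x := by
  obtain ⟨C, hC⟩ : ∃ C, ∀ i : uIcc 0 r, ‖T i‖ ≤ C := by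
    apply banach_steinhaus
    intro z
    obtain ⟨C, hC⟩ := (isCompact_uIcc (a := 0) (b := r)).exists_bound_of_continuousOn
      (hT.continuous z).continuousOn
    exact ⟨C, fun i => hC i i.2⟩
  refine ⟨LinearMap.mkContinuous
    { toFun := fun x => ∫ σ in (0 : ℝ)..r, T σ x
      map_add' := fun x y => by
        rw [← intervalIntegral.integral_add ((hT.continuous x).intervalIntegrable _ _)
          ((hT.continuous y).intervalIntegrable _ _)]
        exact intervalIntegral.integral_congr fun s _ => (T s).map_add x y
      map_smul' := fun c x => by
        rw [RingHom.id_apply, ← intervalIntegral.integral_smul]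
        exact intervalIntegral.integral_congr fun s _ => (T s).map_smul c x }
    (C * |r - 0|) fun x => ?_, fun x => rfl⟩
  calc ‖∫ σ in (0 : ℝ)..r, T σ x‖ ≤ (C * ‖x‖) * |r - 0| := by
        refine intervalIntegral.norm_integral_le_of_norm_le_const fun s hs => ?_
        exact (T s).le_of_opNorm_le (hC ⟨s, uIoc_subset_uIcc hs⟩) x
    _ = _ := by ring

/-- The Duhamel formula. -/
def duhamel (T : ℝ → X →L[ℂ] X) (φ : X) (f : ℝ → X) (t : ℝ) : X :=
  T t φ + ∫ τ in (0 : ℝ)..t, T (t - τ) (f τ)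

lemma IsC0Group.continuous_neg_apply [CompleteSpace X] (hT : IsC0Group T) {f : ℝ → X}
    (hf : Continuous f) : Continuous fun t => T (-t) (f t) :=
  (continuous_uncurry_of_strong hT.continuous).comp (continuous_neg.prodMk hf)

/-- With `T t` pulled out, the integrand no longer depends on `t`, so the fundamental theorem of
calculus applies to the inner integral. -/
lemma duhamel_eq [CompleteSpace X] (hT : IsC0Group T) (φ : X) {f : ℝ → X} (hf : Continuous f)
    (t : ℝ) : duhamel T φ f t = T t (φ + ∫ τ in (0 : ℝ)..t, T (-τ) (f τ)) := by
  rw [duhamel, map_add,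
    ← (T t).intervalIntegral_comp_comm ((hT.continuous_neg_apply hf).intervalIntegrable _ _)]
  simp only [hT.apply_apply, ← sub_eq_add_neg]

lemma continuous_duhamel [CompleteSpace X] (hT : IsC0Group T) (φ : X) {f : ℝ → X}
    (hf : Continuous f) : Continuous (duhamel T φ f) := by
  have h1 : Continuous fun t => φ + ∫ τ in (0 : ℝ)..t, T (-τ) (f τ) :=
    continuous_const.add (continuous_iff_continuousAt.2 fun t =>
      (HasDerivAt.integral_of_continuous (hT.continuous_neg_apply hf) t).continuousAt)
  have h2 := (continuous_uncurry_of_strong hT.continuous).comp (continuous_id.prodMk h1)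
  exact h2.congr fun t => (duhamel_eq hT φ hf t).symm

/-- The primitive of the Duhamel function lies in the domain of the generator. -/
lemma hasOrbitDeriv_integral_duhamel [CompleteSpace X] (hT : IsC0Group T) (φ : X) {f : ℝ → X}
    (hf : Continuous f) (t : ℝ) :
    HasOrbitDeriv T (∫ s in (0 : ℝ)..t, duhamel T φ f s)
      (duhamel T φ f t - φ - ∫ s in (0 : ℝ)..t, f s) := by
  apply hasOrbitDeriv_of_integral hT
  intro r
  obtain ⟨R, hR⟩ := hT.exists_integralCLM r
  set v := duhamel T φ f with hv
  have hvc : Continuous v := continuous_duhamel hT φ hf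
  set w : ℝ → X := fun t => φ + ∫ τ in (0 : ℝ)..t, T (-τ) (f τ) with hw
  have hw' : ∀ t, HasDerivAt w (T (-t) (f t)) t := fun t =>
    (HasDerivAt.integral_of_continuous (hT.continuous_neg_apply hf) t).const_add φ
  -- With `R = ∫₀ʳ T(σ) dσ`, the curve `R (T t x)` is the integral of the orbit over a moving
  -- window. It is differentiable in `t` for every `x`, even when the orbit of `x` is not.
  have hRT : ∀ t x, R (T t x) = ∫ σ in t..(r + t), T σ x := by
    intro t x
    rw [hR]
    simp only [hT.apply_apply]
    rw [intervalIntegral.integral_comp_add_right (fun σ => T σ x), zero_add]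
  have hRTd : ∀ t x, HasDerivAt (fun t => (R ∘L T t) x) (T (r + t) x - T t x) t := by
    intro t x
    have h1 : ∀ t, (R ∘L T t) x = (∫ σ in (0 : ℝ)..(r + t), T σ x) - ∫ σ in (0 : ℝ)..t, T σ x := by
      intro t
      rw [ContinuousLinearMap.comp_apply, hRT, eq_sub_iff_add_eq, add_comm]
      exact intervalIntegral.integral_add_adjacent_intervals
        ((hT.continuous x).intervalIntegrable _ _) ((hT.continuous x).intervalIntegrable _ _)
    have h2 := HasDerivAt.integral_of_continuous (hT.continuous x) t
    have h3 := HasDerivAt.integral_of_continuous (hT.continuous x) (r + t)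
    have h4 := h3.comp_const_add r t
    exact (h4.sub h2).congr_of_eventuallyEq (.of_forall h1)
  have hRv : ∀ t, HasDerivAt (fun t => R (v t)) (T r (v t) - v t + R (f t)) t := by
    intro t
    have h1 := HasDerivAt.strong_apply (K := fun t => R ∘L T t)
      (fun x => R.continuous.comp (hT.continuous x)) (hw' t) (hRTd t (w t))
    refine (h1.congr_of_eventuallyEq (.of_forall fun s => ?_)).congr_deriv ?_
    · simp only [ContinuousLinearMap.comp_apply]
      rw [hv, duhamel_eq hT φ hf]
    · simp only [ContinuousLinearMap.comp_apply, hT.apply_neg_apply]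
      rw [hv, duhamel_eq hT φ hf, hT.apply_apply]
  have hLd : ∀ t, HasDerivAt (fun t => T r (∫ s in (0 : ℝ)..t, v s)) (T r (v t)) t := fun t =>
    ((T r).restrictScalars ℝ).hasFDerivAt.comp_hasDerivAt t
      (HasDerivAt.integral_of_continuous hvc t)
  have hFd : ∀ t, HasDerivAt (fun t => R (∫ s in (0 : ℝ)..t, f s)) (R (f t)) t := fun t =>
    (R.restrictScalars ℝ).hasFDerivAt.comp_hasDerivAt t
      (HasDerivAt.integral_of_continuous hf t)
  -- The required identity `T r (∫v) - ∫v = R (v t - φ - ∫f)` is proved by differentiating in `t`;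
  -- at `t = 0` both sides vanish.
  have hD : ∀ t, HasDerivAt (fun t => T r (∫ s in (0 : ℝ)..t, v s) - (∫ s in (0 : ℝ)..t, v s)
      - R (v t) + R (∫ s in (0 : ℝ)..t, f s)) 0 t := by
    intro t
    refine ((((hLd t).sub (HasDerivAt.integral_of_continuous hvc t)).sub (hRv t)).add
      (hFd t)).congr_deriv ?_
    abel
  have hconst := is_const_of_deriv_eq_zero (fun t => (hD t).differentiableAt)
    (fun t => (hD t).deriv) t 0
  have hv0 : v 0 = φ := by simp [hv, duhamel, hT.zero_apply]
  simp only [intervalIntegral.integral_same, map_zero, hv0] at hconst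
  rw [← hR, map_sub, map_sub, ← sub_eq_zero]
  rw [← sub_eq_zero] at hconst
  rw [← hconst]
  abel

/-- Uniqueness for the homogeneous integrated problem. -/
lemma eq_zero_of_hasOrbitDeriv_integral [CompleteSpace X] (hT : IsC0Group T) {d : ℝ → X}
    (hd : Continuous d) {J : Set ℝ} (hJ : J.OrdConnected) (h0 : (0 : ℝ) ∈ J)
    (h : ∀ t ∈ J, HasOrbitDeriv T (∫ s in (0 : ℝ)..t, d s) (d t)) {t : ℝ} (ht : t ∈ J) :
    d t = 0 := by
  set W : ℝ → X := fun t => ∫ s in (0 : ℝ)..t, d s with hW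
  have hWd : ∀ t, HasDerivAt W (d t) t := HasDerivAt.integral_of_continuous hd
  -- The primitive `W` solves `W' = AW`, where `A` is the generator of `T`, so transporting it back
  -- by `T (-t)` gives a constant.
  have hD : ∀ s ∈ J, HasDerivAt (fun t => T (-t) (W t)) 0 s := by
    intro s hs
    have h1 : HasDerivAt (fun t => T (-t) (W s)) (-(T (-s) (d s))) s := by
      have := ((h s hs).hasDerivAt hT (-s)).scomp s (hasDerivAt_neg s)
      simpa [Function.comp_def] using this
    have h2 := HasDerivAt.strong_apply (K := fun t => T (-t))
      (fun x => (hT.continuous x).comp continuous_neg) (hWd s) h1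
    simpa using h2
  have hsub : uIcc 0 t ⊆ J := hJ.uIcc_subset h0 ht
  have hc := (convex_uIcc (0 : ℝ) t).is_const_of_fderivWithin_eq_zero (𝕜 := ℝ)
    (f := fun t => T (-t) (W t))
    (fun s hs => (hD s (hsub hs)).differentiableAt.differentiableWithinAt)
    (fun s hs => by
      -- For `t = 0` the interval is a single point, and `fderivWithin` is zero there by convention.
      by_cases hu : UniqueDiffWithinAt ℝ (uIcc 0 t) s
      · rw [((hD s (hsub hs)).hasFDerivAt.hasFDerivWithinAt).fderivWithin hu]
        ext; simp
      · exact fderivWithin_zero_of_not_uniqueDiffWithinAt hu) right_mem_uIcc left_mem_uIcc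
  have hW0 : W 0 = 0 := by simp [hW]
  simp only [hW0, map_zero] at hc
  have hWt : W t = 0 := by rw [← hT.apply_neg_apply t (W t), hc, map_zero]
  have h1 := h t ht
  change HasOrbitDeriv T (W t) (d t) at h1
  rw [hWt, HasOrbitDeriv] at h1
  simp only [map_zero, sub_zero, smul_zero] at h1
  exact tendsto_nhds_unique h1 tendsto_const_nhds

lemma IsTimeInterval.ordConnected {J : Set ℝ} (hJ : IsTimeInterval J) : J.OrdConnected := by
  rcases hJ with rfl | ⟨β, rfl⟩ | ⟨α, β, rfl⟩ | ⟨α, rfl⟩ <;> infer_instance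

/-- Composition with a retraction extends functions continuous on `J` to all of `ℝ` without changing
their integrals from `0` to points of `J`. The whole-line results then serve every interval. -/
lemma IsTimeInterval.exists_retraction {J : Set ℝ} (hJ : IsTimeInterval J) (h0 : (0 : ℝ) ∈ J) :
    ∃ ρ : ℝ → ℝ, Continuous ρ ∧ (∀ t, ρ t ∈ J) ∧ ∀ t ∈ J, ρ t = t := by
  rcases hJ with rfl | ⟨β, rfl⟩ | ⟨α, β, rfl⟩ | ⟨α, rfl⟩
  · exact ⟨id, continuous_id, fun _ => mem_univ _, fun _ _ => rfl⟩
  · exact ⟨fun t => min t β, by fun_prop, fun t => mem_Iic.2 (min_le_right _ _),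
      fun t ht => min_eq_left ht⟩
  · refine ⟨fun t => max α (min t β), by fun_prop,
      fun t => ⟨le_max_left _ _, max_le (h0.1.trans h0.2) (min_le_right _ _)⟩, fun t ht => ?_⟩
    simp only
    rw [min_eq_left ht.2, max_eq_right ht.1]
  · exact ⟨fun t => max α t, by fun_prop, fun t => mem_Ici.2 (le_max_left _ _),
      fun t ht => max_eq_right ht⟩

/-- Expressed through orbits, the equation no longer involves the domain of `A`, and differences of
solutions are taken by subtracting limits. -/
lemma isMildSolution_iff {A : X →ₗ.[ℂ] X} (hA : IsGenerator A T) {J : Set ℝ}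
    {φ : X} {f u : ℝ → X} :
    IsMildSolution A J φ f u ↔ ContinuousOn u J ∧ ∀ t ∈ J,
      HasOrbitDeriv T (∫ τ in (0 : ℝ)..t, u τ) (u t - φ - ∫ τ in (0 : ℝ)..t, f τ) := by
  constructor
  · intro h
    refine ⟨h.continuousOn, fun t ht => (hA _ _).1 ?_⟩
    rw [LinearPMap.mem_graph_iff]
    refine ⟨⟨_, h.mem_domain t ht⟩, rfl, ?_⟩
    simp only
    rw [eq_sub_iff_add_eq, eq_sub_iff_add_eq, h.eq t ht]
    abel
  · rintro ⟨h1, h2⟩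
    have h3 : ∀ t ∈ J, ∃ y : A.domain, (y : X) = (∫ τ in (0 : ℝ)..t, u τ) ∧
        A y = u t - φ - ∫ τ in (0 : ℝ)..t, f τ := fun t ht =>
      A.mem_graph_iff.1 ((hA _ _).2 (h2 t ht))
    refine ⟨h1, fun t ht => ?_, fun t ht => ?_⟩
    · obtain ⟨y, hy, -⟩ := h3 t ht
      exact hy ▸ y.2
    · obtain ⟨y, hy, hAy⟩ := h3 t ht
      have : A ⟨_, hy ▸ y.2⟩ = A y := congrArg A (Subtype.ext hy.symm)
      rw [this, hAy]
      abel

/-- Well-posedness of the inhomogeneous problem in the sense of mild solutions. -/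
theorem IsGenerator.existsUnique_mild [CompleteSpace X] {A : X →ₗ.[ℂ] X} (hT : IsC0Group T)
    (hA : IsGenerator A T) {J : Set ℝ} (hJ : IsTimeInterval J) (h0 : (0 : ℝ) ∈ J) (φ : X)
    {f : ℝ → X} (hf : ContinuousOn f J) :
    ∃ u : ℝ → X, IsMildSolution A J φ f u ∧ (∀ v, IsMildSolution A J φ f v → EqOn v u J) ∧
      ∀ t ∈ J, u t = T t φ + ∫ τ in (0 : ℝ)..t, T (t - τ) (f τ) := by
  obtain ⟨ρ, hρ, hρJ, hρid⟩ := hJ.exists_retraction h0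
  have hext : ∀ {g : ℝ → X}, ContinuousOn g J → Continuous (g ∘ ρ) := fun hg =>
    hg.comp_continuous hρ hρJ
  have hsub : ∀ t ∈ J, uIcc 0 t ⊆ J := fun t ht => hJ.ordConnected.uIcc_subset h0 ht
  have hint : ∀ g : ℝ → X, ∀ t ∈ J, ∫ τ in (0 : ℝ)..t, (g ∘ ρ) τ = ∫ τ in (0 : ℝ)..t, g τ :=
    fun g t ht => intervalIntegral.integral_congr fun s hs => by
      simp [hρid s (hsub t ht hs)]
  have hu := continuous_duhamel hT φ (hext hf)
  have hmild : IsMildSolution A J φ f (duhamel T φ (f ∘ ρ)) := by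
    rw [isMildSolution_iff hA]
    refine ⟨hu.continuousOn, fun t ht => ?_⟩
    rw [← hint f t ht]
    exact hasOrbitDeriv_integral_duhamel hT φ (hext hf) t
  refine ⟨duhamel T φ (f ∘ ρ), hmild, fun v hv t ht => ?_, fun t ht => ?_⟩
  · rw [isMildSolution_iff hA] at hv hmild
    have key := eq_zero_of_hasOrbitDeriv_integral (d := (v - duhamel T φ (f ∘ ρ)) ∘ ρ) hT
      (hext (hv.1.sub hmild.1)) hJ.ordConnected h0 ?_ ht
    · simpa [hρid t ht, sub_eq_zero] using key
    · intro s hs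
      rw [hint _ s hs]
      have h1 := (hv.2 s hs).sub (hmild.2 s hs)
      simp only [Pi.sub_apply, Function.comp_apply, hρid s hs]
      rw [intervalIntegral.integral_sub ((hv.1.mono (hsub s hs)).intervalIntegrable)
        (hu.intervalIntegrable _ _)]
      rw [HasOrbitDeriv]
      refine (h1.congr fun h => ?_).trans_eq ?_
      · rw [← smul_sub, map_sub]
        congr 1
        abel
      · congr 1
        abel
  · rw [duhamel]
    congr 1
    exact intervalIntegral.integral_congr fun s hs => by simp [hρid s (hsub t ht hs)]

/-- A strongly continuous group is determined by its generator. -/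
theorem IsGenerator.group_unique [CompleteSpace X] {A : X →ₗ.[ℂ] X} {S : ℝ → X →L[ℂ] X}
    (hT : IsC0Group T) (hA : IsGenerator A T) (hS : IsC0Group S) (hAS : IsGenerator A S) :
    S = T := by
  have h0 : (0 : ℝ) ∈ (univ : Set ℝ) := mem_univ 0
  ext t φ
  -- With zero forcing, the orbits of both groups are mild solutions of one problem for `A`.
  obtain ⟨u, -, hu, -⟩ := hA.existsUnique_mild hT (Or.inl rfl) h0 φ
    (continuousOn_const (c := (0 : X)))
  obtain ⟨u₁, h₁, -, e₁⟩ := hA.existsUnique_mild hT (Or.inl rfl) h0 φ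
    (continuousOn_const (c := (0 : X)))
  obtain ⟨u₂, h₂, -, e₂⟩ := hAS.existsUnique_mild hS (Or.inl rfl) h0 φ
    (continuousOn_const (c := (0 : X)))
  have h3 := (hu u₂ h₂ (mem_univ t)).trans (hu u₁ h₁ (mem_univ t)).symm
  rw [e₁ t (mem_univ t), e₂ t (mem_univ t)] at h3
  simpa using h3

end AbstractGroups

/-! ### Bounded perturbation of an isometric group. -/

section Perturbation

variable {X : Type*} [NormedAddCommGroup X] [NormedSpace ℂ X] [NormedSpace ℝ X]
  [IsScalarTower ℝ ℂ X] [CompleteSpace X]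

open scoped BoundedContinuousFunction

/-- The weight `cosh (μt)` grows in both time directions, so one weighted norm works on the whole
line. The factor `μ⁻¹` is what makes the Volterra operator a contraction for large `μ`. -/
lemma abs_integral_cosh_le {μ : ℝ} (hμ : 0 < μ) (t : ℝ) :
    |∫ s in (0 : ℝ)..t, Real.cosh (μ * s)| ≤ μ⁻¹ * Real.cosh (μ * t) := by
  have h1 : ∀ s, HasDerivAt (fun s => μ⁻¹ * Real.sinh (μ * s)) (Real.cosh (μ * s)) s := by
    intro s
    have h2 := (((hasDerivAt_id s).const_mul μ).sinh).const_mul μ⁻¹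
    refine h2.congr_deriv ?_
    simp only [id]
    field_simp
  rw [intervalIntegral.integral_eq_sub_of_hasDerivAt (fun s _ => h1 s)
    ((by fun_prop : Continuous fun s => Real.cosh (μ * s)).intervalIntegrable _ _)]
  simp only [mul_zero, Real.sinh_zero, sub_zero, abs_mul, abs_inv, abs_of_pos hμ]
  gcongr
  rw [Real.abs_sinh]
  exact (Real.sinh_lt_cosh _).le.trans (Real.cosh_abs _).le

/-- The Volterra operator `z ↦ cosh(μt)⁻¹ ∫₀ᵗ cosh(μs) Q(s) z(s) ds` on bounded continuous
functions. -/
lemma exists_volterra {Q : ℝ → X →L[ℂ] X} (hQ : ∀ x, Continuous fun t => Q t x) {c : ℝ}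
    (hc0 : 0 ≤ c) (hc : ∀ t, ‖Q t‖ ≤ c) {μ : ℝ} (hμ : 0 < μ) :
    ∃ K : (ℝ →ᵇ X) →L[ℂ] (ℝ →ᵇ X), ‖K‖ ≤ c * μ⁻¹ ∧ ∀ z t, K z t =
      (Real.cosh (μ * t))⁻¹ • ∫ s in (0 : ℝ)..t, Real.cosh (μ * s) • Q s (z s) := by
  have hcont : ∀ z : ℝ →ᵇ X, Continuous fun s => Real.cosh (μ * s) • Q s (z s) := fun z => by
    have h1 := (continuous_uncurry_of_strong hQ).comp (continuous_id.prodMk z.continuous)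
    exact (by fun_prop : Continuous fun s => Real.cosh (μ * s)).smul h1
  have hbound : ∀ (z : ℝ →ᵇ X) (t : ℝ), ‖(Real.cosh (μ * t))⁻¹ •
      ∫ s in (0 : ℝ)..t, Real.cosh (μ * s) • Q s (z s)‖ ≤ c * μ⁻¹ * ‖z‖ := by
    intro z t
    have hp := Real.cosh_pos (μ * t)
    have h1 : ‖∫ s in (0 : ℝ)..t, Real.cosh (μ * s) • Q s (z s)‖ ≤
        |∫ s in (0 : ℝ)..t, (c * ‖z‖) * Real.cosh (μ * s)| := by
      refine intervalIntegral.norm_integral_le_abs_of_norm_le (.of_forall fun s => ?_)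
        ((by fun_prop : Continuous fun s => (c * ‖z‖) * Real.cosh (μ * s)).intervalIntegrable _ _)
      rw [norm_smul, Real.norm_of_nonneg (Real.cosh_pos _).le, mul_comm]
      gcongr
      exact ((Q s).le_of_opNorm_le (hc s) _).trans (by gcongr; exact z.norm_coe_le_norm s)
    rw [intervalIntegral.integral_const_mul, abs_mul,
      abs_of_nonneg (mul_nonneg hc0 (norm_nonneg z))] at h1
    rw [norm_smul, norm_inv, Real.norm_of_nonneg hp.le, inv_mul_le_iff₀ hp]
    calc _ ≤ _ := h1
      _ ≤ c * ‖z‖ * (μ⁻¹ * Real.cosh (μ * t)) := by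
        gcongr
        exact abs_integral_cosh_le hμ t
      _ = _ := by ring
  have hct : ∀ z : ℝ →ᵇ X, Continuous fun t => (Real.cosh (μ * t))⁻¹ •
      ∫ s in (0 : ℝ)..t, Real.cosh (μ * s) • Q s (z s) := fun z =>
    ((by fun_prop : Continuous fun s => Real.cosh (μ * s)).inv₀ fun t =>
      (Real.cosh_pos _).ne').smul (continuous_iff_continuousAt.2 fun t =>
        (HasDerivAt.integral_of_continuous (hcont z) t).continuousAt)
  refine ⟨LinearMap.mkContinuous
    { toFun := fun z => BoundedContinuousFunction.ofNormedAddCommGroup _ (hct z) _ (hbound z)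
      map_add' := fun z z' => by
        ext t
        simp only [BoundedContinuousFunction.coe_ofNormedAddCommGroup,
          BoundedContinuousFunction.add_apply, map_add, smul_add]
        rw [intervalIntegral.integral_add ((hcont z).intervalIntegrable _ _)
          ((hcont z').intervalIntegrable _ _), smul_add]
      map_smul' := fun a z => by
        ext t
        simp only [BoundedContinuousFunction.coe_ofNormedAddCommGroup,
          BoundedContinuousFunction.smul_apply, map_smul, RingHom.id_apply]
        rw [smul_comm a, ← intervalIntegral.integral_smul a]
        congr 1
        exact intervalIntegral.integral_congr fun s _ =>
          smul_comm (Real.cosh (μ * s)) a (Q s (z s)) } (c * μ⁻¹) fun z => ?_, ?_, fun z t => rfl⟩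
  · exact BoundedContinuousFunction.norm_ofNormedAddCommGroup_le _ (by positivity) (hbound z)
  · exact LinearMap.mkContinuous_norm_le _ (by positivity) _

/-- Global solvability of `w' = Q(t) w` for a bounded strongly continuous family `Q`. -/
lemma exists_propagator {Q : ℝ → X →L[ℂ] X} (hQ : ∀ x, Continuous fun t => Q t x) {c : ℝ}
    (hc0 : 0 ≤ c) (hc : ∀ t, ‖Q t‖ ≤ c) :
    ∃ W : ℝ → X →L[ℂ] X, (∀ x, W 0 x = x) ∧
      ∀ x t, HasDerivAt (fun t => W t x) (Q t (W t x)) t := by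
  -- Any `μ > c` would do: the Volterra operator has norm at most `c / μ < 1`.
  have hμ : 0 < c + 1 := by linarith
  set μ := c + 1
  obtain ⟨K, hK, hKapp⟩ := exists_volterra hQ hc0 hc hμ
  have hK1 : ‖K‖ < 1 := hK.trans_lt (by rw [← div_eq_mul_inv, div_lt_one hμ]; linarith)
  have hch : Continuous fun t => Real.cosh (μ * t) := by fun_prop
  have hne : ∀ t, Real.cosh (μ * t) ≠ 0 := fun t => (Real.cosh_pos _).ne'
  have hib : ∀ x : X, ∀ t, ‖(Real.cosh (μ * t))⁻¹ • x‖ ≤ 1 * ‖x‖ := fun x t => by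
    rw [norm_smul, norm_inv, Real.norm_of_nonneg (Real.cosh_pos _).le]
    gcongr
    exact inv_le_one_of_one_le₀ (Real.one_le_cosh _)
  let ι : X →L[ℂ] (ℝ →ᵇ X) := LinearMap.mkContinuous
    { toFun := fun x => BoundedContinuousFunction.ofNormedAddCommGroup
        (fun t => (Real.cosh (μ * t))⁻¹ • x) ((hch.inv₀ hne).smul continuous_const) _ (hib x)
      map_add' := fun x y => by ext t; simp
      map_smul' := fun a x => by ext t; simp [smul_comm a] } 1 fun x =>
        BoundedContinuousFunction.norm_ofNormedAddCommGroup_le _ (by positivity) (hib x)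
  have hι : ∀ x t, ι x t = (Real.cosh (μ * t))⁻¹ • x := fun x t => rfl
  let N : (ℝ →ᵇ X) →L[ℂ] (ℝ →ᵇ X) := ((Units.oneSub K hK1)⁻¹ : ((ℝ →ᵇ X) →L[ℂ] (ℝ →ᵇ X))ˣ)
  have hN : ∀ z, N z - K (N z) = z := fun z => by
    have h1 : (1 - K) * N = 1 := by
      rw [← Units.val_oneSub K hK1]; exact Units.mul_inv _
    simpa using congrArg (fun F => F z) h1
  -- `N = (1 - K)⁻¹` solves the integral equation divided by the weight; the factor `cosh (μt)`
  -- restores the actual solution.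
  let W : ℝ → X →L[ℂ] X := fun t => (Real.cosh (μ * t) : ℂ) •
    ((BoundedContinuousFunction.evalCLM ℂ t : (ℝ →ᵇ X) →L[ℂ] X) ∘L N ∘L ι)
  have hW : ∀ t x, W t x = Real.cosh (μ * t) • N (ι x) t := fun t x => by
    rw [← algebraMap_smul ℂ (Real.cosh (μ * t))]
    rfl
  have hcont : ∀ z : ℝ →ᵇ X, Continuous fun s => Real.cosh (μ * s) • Q s (z s) := fun z =>
    hch.smul ((continuous_uncurry_of_strong hQ).comp (continuous_id.prodMk z.continuous))
  have hWeq : ∀ t x, W t x = x + ∫ s in (0 : ℝ)..t, Real.cosh (μ * s) • Q s (N (ι x) s) := by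
    intro t x
    have h1 := congrArg (fun z : ℝ →ᵇ X => z t) (hN (ι x))
    simp only [BoundedContinuousFunction.sub_apply, hKapp, hι] at h1
    rw [hW, sub_eq_iff_eq_add.1 h1, smul_add, smul_inv_smul₀ (hne t), smul_inv_smul₀ (hne t)]
  refine ⟨W, fun x => by simp [hWeq], fun x t => ?_⟩
  refine (((HasDerivAt.integral_of_continuous (hcont (N (ι x))) t).const_add
    x).congr_of_eventuallyEq (.of_forall fun s => hWeq s x)).congr_deriv ?_
  rw [hW, (Q t).map_smul_of_tower]

/-- Bounded perturbation of an isometric group. -/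
theorem exists_perturbedGroup {T₀ : ℝ → X →L[ℂ] X} (h₀ : IsC0Group T₀) (hn : ∀ t, ‖T₀ t‖ ≤ 1)
    (C : X →L[ℂ] X) : ∃ T : ℝ → X →L[ℂ] X, IsC0Group T ∧
      ∀ x y, HasOrbitDeriv T x y ↔ HasOrbitDeriv T₀ x (y - C x) := by
  -- Interaction picture: the group is sought as `T₀ t ∘ W t`, which leads to `W' = Q(t) W` with a
  -- family `Q` bounded by `‖C‖` because each `T₀ t` has norm at most one.
  set Q : ℝ → X →L[ℂ] X := fun t => T₀ (-t) ∘L C ∘L T₀ t with hQdef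
  have hQ : ∀ x, Continuous fun t => Q t x := fun x =>
    h₀.continuous_neg_apply (C.continuous.comp (h₀.continuous x))
  have hc : ∀ t, ‖Q t‖ ≤ ‖C‖ := fun t => by
    refine (ContinuousLinearMap.opNorm_comp_le _ _).trans ?_
    calc ‖T₀ (-t)‖ * ‖C ∘L T₀ t‖ ≤ 1 * (‖C‖ * 1) := by
          gcongr
          · exact hn _
          · exact (ContinuousLinearMap.opNorm_comp_le _ _).trans (by gcongr; exact hn _)
      _ = _ := by ring
  obtain ⟨W, hW0, hW⟩ := exists_propagator hQ (norm_nonneg C) hc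
  have hlip : ∀ t, LipschitzOnWith ‖C‖₊ (Q t) univ := fun t =>
    ((Q t).lipschitz.weaken (hc t)).lipschitzOnWith
  have hWc : ∀ x, Continuous fun t => W t x := fun x =>
    continuous_iff_continuousAt.2 fun t => (hW x t).continuousAt
  -- This identity is the group law for `T₀ t ∘ W t`. As functions of `s`, both sides solve `z' =
  -- Q(s) z` with the same value at `s = 0`.
  have hcocycle : ∀ s t x, T₀ t (W (s + t) x) = W s (T₀ t (W t x)) := by
    intro s t x
    have h1 : ∀ s, HasDerivAt (fun s => T₀ t (W (s + t) x)) (Q s (T₀ t (W (s + t) x))) s := by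
      intro s
      refine (((T₀ t).restrictScalars ℝ).hasFDerivAt.comp_hasDerivAt s
        ((hW x (s + t)).comp_add_const s t)).congr_deriv ?_
      simp only [hQdef, ContinuousLinearMap.coe_restrictScalars', ContinuousLinearMap.comp_apply,
        h₀.apply_apply]
      congr 2
      ring
    have h2 := ODE_solution_unique_univ (v := fun t x => Q t x) (s := fun _ => univ) (t₀ := 0)
      hlip (f := fun s => T₀ t (W (s + t) x)) (g := fun s => W s (T₀ t (W t x)))
      (fun s => ⟨h1 s, mem_univ _⟩) (fun s => ⟨hW _ s, mem_univ _⟩) (by simp [hW0])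
    exact congrFun h2 s
  have hTc : ∀ x, Continuous fun t => T₀ t (W t x) := fun x =>
    (continuous_uncurry_of_strong h₀.continuous).comp (continuous_id.prodMk (hWc x))
  have hT : IsC0Group fun t => T₀ t ∘L W t := by
    refine ⟨?_, fun s t => ?_, hTc⟩
    · ext x
      simp [hW0, h₀.zero_apply]
    · ext x
      simp only [ContinuousLinearMap.comp_apply, mul_apply_eq_comp]
      rw [← hcocycle, h₀.apply_apply]
  refine ⟨_, hT, fun x y => ?_⟩
  -- The difference quotients of the two groups differ by this term, which converges to `C x` for
  -- every `x`; hence the generators have the same domain.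
  have h1 : Tendsto (fun h : ℝ => T₀ h ((h : ℂ)⁻¹ • (W h x - x))) (𝓝[≠] 0) (𝓝 (C x)) := by
    have h2 := (hW x 0).tendsto_slope
    have h3 : Tendsto (fun h : ℝ => (h, (h : ℂ)⁻¹ • (W h x - x))) (𝓝[≠] 0) (𝓝 (0, C x)) := by
      refine (tendsto_id.mono_left nhdsWithin_le_nhds).prodMk_nhds ?_
      simp only [hQdef, ContinuousLinearMap.comp_apply, hW0, neg_zero, h₀.zero_apply] at h2
      refine h2.congr fun h => ?_
      rw [slope_def_module, hW0, sub_zero, ← algebraMap_smul ℂ h⁻¹, Complex.coe_algebraMap,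
        Complex.ofReal_inv]
    have h4 := ((continuous_uncurry_of_strong h₀.continuous).tendsto (0, C x)).comp h3
    simpa [Function.comp_def, h₀.zero_apply] using h4
  have hsplit : ∀ h : ℝ, (h : ℂ)⁻¹ • ((T₀ h ∘L W h) x - x) =
      (h : ℂ)⁻¹ • (T₀ h x - x) + T₀ h ((h : ℂ)⁻¹ • (W h x - x)) := by
    intro h
    rw [map_smul, ← smul_add, map_sub, ContinuousLinearMap.comp_apply]
    congr 1
    abel
  constructor
  · intro h
    exact (Tendsto.sub h h1).congr fun t => by rw [hsplit]; abel
  · intro h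
    have h2 := Tendsto.add h h1
    rw [sub_add_cancel] at h2
    exact h2.congr fun t => (hsplit t).symm

/-- Transport of a group along an isomorphism. -/
lemma IsC0Group.conj {Y : Type*} [NormedAddCommGroup Y] [NormedSpace ℂ Y]
    {T : ℝ → X →L[ℂ] X} (hT : IsC0Group T) (e : Y ≃L[ℂ] X) :
    IsC0Group fun t => (e.symm : X →L[ℂ] Y) ∘L T t ∘L (e : Y →L[ℂ] X) := by
  refine ⟨?_, fun s t => ?_, fun y => ?_⟩
  · ext y
    simp [hT.zero_apply]
  · ext y
    simp [← hT.apply_apply]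
  · exact e.symm.continuous.comp (hT.continuous (e y))

lemma hasOrbitDeriv_conj {Y : Type*} [NormedAddCommGroup Y] [NormedSpace ℂ Y]
    {T : ℝ → X →L[ℂ] X} (e : Y ≃L[ℂ] X) (x y : Y) :
    HasOrbitDeriv (fun t => (e.symm : X →L[ℂ] Y) ∘L T t ∘L (e : Y →L[ℂ] X)) x y ↔
      HasOrbitDeriv T (e x) (e y) := by
  constructor
  · intro h
    refine ((e.continuous.tendsto _).comp h).congr fun t => ?_
    simp
  · intro h
    have h2 := (e.symm.continuous.tendsto _).comp h
    rw [e.symm_apply_apply] at h2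
    refine h2.congr fun t => ?_
    simp

end Perturbation

/-! ### Cauchy–Schwarz for square summable families. -/

section SquareSummable

lemma memℓp_two_iff {ι : Type*} {E : ι → Type*} [∀ i, NormedAddCommGroup (E i)] {f : ∀ i, E i} :
    Memℓp f 2 ↔ Summable fun i => ‖f i‖ ^ 2 := by
  rw [memℓp_gen_iff (by norm_num)]
  simp

lemma summable_mul_of_sq {ι : Type*} {f g : ι → ℝ} (hf : ∀ i, 0 ≤ f i) (hg : ∀ i, 0 ≤ g i)
    (hf2 : Summable fun i => f i ^ 2) (hg2 : Summable fun i => g i ^ 2) :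
    Summable fun i => f i * g i :=
  (hf2.add hg2).of_nonneg_of_le (fun i => mul_nonneg (hf i) (hg i)) fun i => by
    nlinarith [sq_nonneg (f i - g i), sq_nonneg (f i), sq_nonneg (g i)]

lemma sq_tsum_mul_le {ι : Type*} {f g : ι → ℝ} (hf : ∀ i, 0 ≤ f i) (hg : ∀ i, 0 ≤ g i)
    (hf2 : Summable fun i => f i ^ 2) (hg2 : Summable fun i => g i ^ 2) :
    (∑' i, f i * g i) ^ 2 ≤ (∑' i, f i ^ 2) * ∑' i, g i ^ 2 := by
  have h0 : 0 ≤ ∑' i, f i * g i := tsum_nonneg fun i => mul_nonneg (hf i) (hg i)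
  have h1 : ∑' i, f i * g i ≤ √((∑' i, f i ^ 2) * ∑' i, g i ^ 2) := by
    refine (summable_mul_of_sq hf hg hf2 hg2).tsum_le_of_sum_le fun s => ?_
    refine Real.le_sqrt_of_sq_le ((Finset.sum_mul_sq_le_sq_mul_sq s f g).trans ?_)
    exact mul_le_mul (hf2.sum_le_tsum s fun i _ => sq_nonneg _)
      (hg2.sum_le_tsum s fun i _ => sq_nonneg _) (Finset.sum_nonneg fun i _ => sq_nonneg _)
      (tsum_nonneg fun i => sq_nonneg _)
  calc _ ≤ (√((∑' i, f i ^ 2) * ∑' i, g i ^ 2)) ^ 2 := by gcongr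
    _ = _ := Real.sq_sqrt (mul_nonneg (tsum_nonneg fun i => sq_nonneg _)
        (tsum_nonneg fun i => sq_nonneg _))

end SquareSummable

section Sequences

variable {H : Type*} [NormedAddCommGroup H] [InnerProductSpace ℂ H]

/-- The space `ℓ²(ℤ, H)`. -/
abbrev Seq2 (H : Type*) [NormedAddCommGroup H] : Type _ := lp (fun _ : ℤ => H) 2

lemma Seq2.summable (x : Seq2 H) : Summable fun n => ‖x n‖ ^ 2 :=
  memℓp_two_iff.1 (lp.memℓp x)

lemma Seq2.norm_sq (x : Seq2 H) : ‖x‖ ^ 2 = ∑' n, ‖x n‖ ^ 2 := by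
  have h := lp.norm_rpow_eq_tsum (p := 2) (by norm_num) x
  simpa using h

/-- Dominated convergence in `ℓ²(ℤ, H)`. -/
lemma Seq2.tendsto_of_dominated {α : Type*} {l : Filter α} {F : α → Seq2 H} {g : Seq2 H}
    {b : ℤ → ℝ} (hb : Summable fun n => b n ^ 2)
    (hFb : ∀ᶠ a in l, ∀ n, ‖F a n - g n‖ ≤ b n)
    (hF : ∀ n, Tendsto (fun a => F a n) l (𝓝 (g n))) : Tendsto F l (𝓝 g) := by
  rw [tendsto_iff_norm_sub_tendsto_zero]
  have h1 : Tendsto (fun a => ∑' n, ‖F a n - g n‖ ^ 2) l (𝓝 (∑' _ : ℤ, (0 : ℝ))) := by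
    refine tendsto_tsum_of_dominated_convergence hb (fun n => ?_) ?_
    · have h2 := (((hF n).sub_const (g n)).norm).pow 2
      simpa using h2
    · filter_upwards [hFb] with a ha n
      rw [Real.norm_of_nonneg (sq_nonneg _)]
      exact pow_le_pow_left₀ (norm_nonneg _) (ha n) 2
  have h2 : Tendsto (fun a => ‖F a - g‖ ^ 2) l (𝓝 0) := by
    rw [tsum_zero] at h1
    refine h1.congr fun a => ?_
    rw [Seq2.norm_sq]
    simp
  have h3 := h2.sqrt
  simpa using h3

/-! ### Operators on `ℓ²(ℤ, H)` with square summable matrices. -/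

section HilbertSchmidt

/-- Square summability of the operator norms of the entries of an infinite operator matrix. -/
def IsHS (M : ℤ → ℤ → H →L[ℂ] H) : Prop := Summable fun p : ℤ × ℤ => ‖M p.1 p.2‖ ^ 2

lemma isHS_iff_memℓp {M : ℤ → ℤ → H →L[ℂ] H} :
    IsHS M ↔ Memℓp (fun p : ℤ × ℤ => M p.1 p.2) 2 := memℓp_two_iff.symm

lemma IsHS.add {M N : ℤ → ℤ → H →L[ℂ] H} (hM : IsHS M) (hN : IsHS N) :
    IsHS fun j n => M j n + N j n :=
  isHS_iff_memℓp.2 ((isHS_iff_memℓp.1 hM).add (isHS_iff_memℓp.1 hN))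

lemma IsHS.sub {M N : ℤ → ℤ → H →L[ℂ] H} (hM : IsHS M) (hN : IsHS N) :
    IsHS fun j n => M j n - N j n :=
  isHS_iff_memℓp.2 ((isHS_iff_memℓp.1 hM).sub (isHS_iff_memℓp.1 hN))

lemma IsHS.const_smul {M : ℤ → ℤ → H →L[ℂ] H} (hM : IsHS M) (c : ℂ) :
    IsHS fun j n => c • M j n :=
  isHS_iff_memℓp.2 ((isHS_iff_memℓp.1 hM).const_smul c)

lemma IsHS.sum {ι : Type*} (s : Finset ι) {M : ι → ℤ → ℤ → H →L[ℂ] H}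
    (hM : ∀ i ∈ s, IsHS (M i)) : IsHS fun j n => ∑ i ∈ s, M i j n :=
  isHS_iff_memℓp.2 (by
    simpa using Memℓp.finsetSum s fun i hi => isHS_iff_memℓp.1 (hM i hi))

lemma IsHS.mono {M N : ℤ → ℤ → H →L[ℂ] H} (hM : IsHS M) (h : ∀ j n, ‖N j n‖ ≤ ‖M j n‖) :
    IsHS N :=
  Summable.of_nonneg_of_le (fun _ => sq_nonneg _)
    (fun p => pow_le_pow_left₀ (norm_nonneg _) (h p.1 p.2) 2) hM

lemma IsHS.row {M : ℤ → ℤ → H →L[ℂ] H} (hM : IsHS M) (j : ℤ) :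
    Summable fun n => ‖M j n‖ ^ 2 := hM.prod_factor j

lemma summable_row_apply {m : ℤ → H →L[ℂ] H} (hm : Summable fun n => ‖m n‖ ^ 2) (x : Seq2 H) :
    Summable fun n => ‖m n (x n)‖ :=
  (summable_mul_of_sq (fun _ => norm_nonneg _) (fun _ => norm_nonneg _) hm
    x.summable).of_nonneg_of_le (fun _ => norm_nonneg _) fun n => (m n).le_opNorm _

lemma norm_sq_row_apply_le {m : ℤ → H →L[ℂ] H} (hm : Summable fun n => ‖m n‖ ^ 2) (x : Seq2 H) :
    ‖∑' n, m n (x n)‖ ^ 2 ≤ (∑' n, ‖m n‖ ^ 2) * ‖x‖ ^ 2 := by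
  have h1 : ‖∑' n, m n (x n)‖ ≤ ∑' n, ‖m n‖ * ‖x n‖ := by
    refine (norm_tsum_le_tsum_norm (summable_row_apply hm x)).trans ?_
    exact (summable_row_apply hm x).tsum_le_tsum (fun n => (m n).le_opNorm _)
      (summable_mul_of_sq (fun _ => norm_nonneg _) (fun _ => norm_nonneg _) hm x.summable)
  calc _ ≤ (∑' n, ‖m n‖ * ‖x n‖) ^ 2 := by gcongr
    _ ≤ _ := by
      rw [Seq2.norm_sq]
      exact sq_tsum_mul_le (fun _ => norm_nonneg _) (fun _ => norm_nonneg _) hm x.summable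

lemma IsHS.summable_sq_apply {M : ℤ → ℤ → H →L[ℂ] H} (hM : IsHS M) (x : Seq2 H) :
    Summable fun j => ‖∑' n, M j n (x n)‖ ^ 2 :=
  (hM.prod.mul_right (‖x‖ ^ 2)).of_nonneg_of_le (fun _ => sq_nonneg _)
    fun j => norm_sq_row_apply_le (hM.row j) x

variable [CompleteSpace H]

/-- The bounded operator on `ℓ²(ℤ, H)` with a square summable matrix. -/
def IsHS.toCLM {M : ℤ → ℤ → H →L[ℂ] H} (hM : IsHS M) : Seq2 H →L[ℂ] Seq2 H :=
  LinearMap.mkContinuous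
    { toFun := fun x => ⟨fun j => ∑' n, M j n (x n), memℓp_two_iff.2 (hM.summable_sq_apply x)⟩
      map_add' := fun x y => by
        ext j
        simp only [lp.coeFn_add, Pi.add_apply, map_add]
        exact (summable_row_apply (hM.row j) x).of_norm.tsum_add
          (summable_row_apply (hM.row j) y).of_norm
      map_smul' := fun c x => by
        ext j
        simp only [lp.coeFn_smul, Pi.smul_apply, map_smul, RingHom.id_apply]
        exact (summable_row_apply (hM.row j) x).of_norm.tsum_const_smul c }
    (√(∑' p : ℤ × ℤ, ‖M p.1 p.2‖ ^ 2)) fun x => by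
      refine le_of_sq_le_sq ?_ (by positivity)
      rw [mul_pow, Real.sq_sqrt (tsum_nonneg fun _ => sq_nonneg _), Seq2.norm_sq, hM.tsum_prod,
        ← tsum_mul_right]
      exact (hM.summable_sq_apply x).tsum_le_tsum (fun j => norm_sq_row_apply_le (hM.row j) x)
        (hM.prod.mul_right _)

lemma IsHS.toCLM_apply {M : ℤ → ℤ → H →L[ℂ] H} (hM : IsHS M) (x : Seq2 H) (j : ℤ) :
    hM.toCLM x j = ∑' n, M j n (x n) := rfl

lemma IsHS.norm_toCLM_le {M : ℤ → ℤ → H →L[ℂ] H} (hM : IsHS M) :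
    ‖hM.toCLM‖ ≤ √(∑' p : ℤ × ℤ, ‖M p.1 p.2‖ ^ 2) :=
  LinearMap.mkContinuous_norm_le _ (Real.sqrt_nonneg _) _

end HilbertSchmidt

/-! ### The unperturbed diagonal group. -/

section DiagonalGroup

/-- The phase `e^{iat}`. -/
def phase (a t : ℝ) : ℂ := Complex.exp (((a * t : ℝ) : ℂ) * Complex.I)

lemma norm_phase (a t : ℝ) : ‖phase a t‖ = 1 := Complex.norm_exp_ofReal_mul_I _

lemma phase_zero (a : ℝ) : phase a 0 = 1 := by simp [phase]

lemma phase_add (a s t : ℝ) : phase a (s + t) = phase a s * phase a t := by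
  rw [phase, phase, phase, ← Complex.exp_add]
  congr 1
  push_cast
  ring

lemma hasDerivAt_phase (a t : ℝ) : HasDerivAt (phase a) (a * Complex.I * phase a t) t := by
  have h1 : HasDerivAt (fun t : ℝ => ((a * t : ℝ) : ℂ) * Complex.I) (a * Complex.I) t := by
    have h2 := (((hasDerivAt_id t).const_mul a).ofReal_comp).mul_const Complex.I
    simpa using h2
  exact h1.cexp.congr_deriv (by rw [phase]; ring)

lemma continuous_phase (a : ℝ) : Continuous (phase a) := by
  unfold phase
  fun_prop

lemma norm_phase_sub_one_le (a t : ℝ) : ‖phase a t - 1‖ ≤ |a| * |t| := by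
  have h := Real.norm_exp_I_mul_ofReal_sub_one_le (x := a * t)
  rw [mul_comm Complex.I] at h
  rwa [Real.norm_eq_abs, abs_mul] at h

/-- The group of diagonal operators `x ↦ (e^{i aₙ t} xₙ)ₙ`. -/
def diagGroup (H : Type*) [NormedAddCommGroup H] [InnerProductSpace ℂ H] (a : ℤ → ℝ) (t : ℝ) :
    Seq2 H →L[ℂ] Seq2 H :=
  LinearMap.mkContinuous
    { toFun := fun x => ⟨fun n => phase (a n) t • x n, memℓp_two_iff.2 (by
        simpa [norm_smul, norm_phase] using x.summable)⟩
      map_add' := fun x y => by ext n; exact smul_add _ (x n) (y n)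
      map_smul' := fun c x => by ext n; exact smul_comm _ c (x n) } 1 fun x => by
    refine le_of_sq_le_sq ?_ (by positivity)
    rw [one_mul, Seq2.norm_sq, Seq2.norm_sq]
    simp [norm_smul, norm_phase]

variable {a : ℤ → ℝ}

lemma diagGroup_apply (t : ℝ) (x : Seq2 H) (n : ℤ) :
    diagGroup H a t x n = phase (a n) t • x n := rfl

lemma norm_diagGroup_le (t : ℝ) : ‖diagGroup H a t‖ ≤ 1 :=
  LinearMap.mkContinuous_norm_le _ zero_le_one _

lemma isC0Group_diagGroup : IsC0Group (diagGroup H a) := by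
  refine ⟨?_, fun s t => ?_, fun x => ?_⟩
  · ext x n
    simp [diagGroup_apply, phase_zero]
  · ext x n
    simp [diagGroup_apply, phase_add, mul_smul]
  · rw [continuous_iff_continuousAt]
    intro t
    refine Seq2.tendsto_of_dominated (b := fun n => 2 * ‖x n‖) ?_ (.of_forall fun s n => ?_)
      fun n => ?_
    · simpa only [mul_pow] using x.summable.mul_left (2 ^ 2)
    · refine (norm_sub_le _ _).trans_eq ?_
      simp only [diagGroup_apply, norm_smul, norm_phase]
      ring
    · exact ((continuous_phase (a n)).smul continuous_const).tendsto t

/-- Convergence in `ℓ²` forces convergence of each coordinate. Conversely `|e^{iat} - 1| ≤ |at|`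
dominates the difference quotients by `‖y n‖`, so the generator has the maximal domain. -/
lemma hasOrbitDeriv_diagGroup {x y : Seq2 H} :
    HasOrbitDeriv (diagGroup H a) x y ↔ ∀ n, y n = ((a n : ℂ) * Complex.I) • x n := by
  have hlim : ∀ n, Tendsto (fun h : ℝ => (h : ℂ)⁻¹ • (diagGroup H a h x - x) n) (𝓝[≠] 0)
      (𝓝 (((a n : ℂ) * Complex.I) • x n)) := by
    intro n
    have h1 := (hasDerivAt_phase (a n) 0).tendsto_slope
    rw [phase_zero, mul_one] at h1
    refine (h1.smul_const (x n)).congr fun h => ?_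
    rw [slope_def_module, phase_zero, sub_zero, lp.coeFn_sub, Pi.sub_apply, diagGroup_apply,
      ← Complex.coe_smul, Complex.ofReal_inv, smul_assoc, sub_smul, one_smul]
  constructor
  · intro h n
    refine tendsto_nhds_unique ?_ (hlim n)
    have h2 : Continuous fun z : Seq2 H => z n := (lp.evalCLM ℂ (fun _ : ℤ => H) 2 n).continuous
    exact (h2.tendsto y).comp h
  · intro h
    refine Seq2.tendsto_of_dominated (b := fun n => 2 * ‖y n‖) ?_ ?_ fun n => ?_
    · simpa only [mul_pow] using y.summable.mul_left (2 ^ 2)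
    · filter_upwards [self_mem_nhdsWithin] with t ht n
      have ht0 : (0 : ℝ) < |t| := abs_pos.2 ht
      refine (norm_sub_le _ _).trans ?_
      rw [two_mul]
      gcongr
      simp only [lp.coeFn_smul, lp.coeFn_sub, Pi.smul_apply, Pi.sub_apply, diagGroup_apply, h n]
      have h3 : phase (a n) t • x n - x n = (phase (a n) t - 1) • x n := by
        rw [sub_smul, one_smul]
      rw [h3, norm_smul, norm_smul, norm_smul, norm_mul, norm_inv, Complex.norm_real,
        Complex.norm_real, Complex.norm_I, Real.norm_eq_abs, Real.norm_eq_abs, mul_one,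
        ← mul_assoc]
      gcongr
      rw [inv_mul_le_iff₀ ht0, mul_comm]
      exact norm_phase_sub_one_le _ _
    · rw [h n]
      exact hlim n

end DiagonalGroup

end Sequences

/-! ### Similarity of the model operator to a bounded perturbation of the diagonal. -/

section Similarity

variable {H : Type*} [NormedAddCommGroup H] [InnerProductSpace ℂ H]

/-- The eigenvalues `ibn` of the unperturbed operator. -/
def freq (b : ℝ) (n : ℤ) : ℂ := ((b * n : ℝ) : ℂ) * Complex.I

lemma freq_sub (b : ℝ) (j n : ℤ) : freq b j - freq b n = (b * Complex.I) * ((j : ℂ) - n) := by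
  simp only [freq]
  push_cast
  ring

lemma freq_sub_ne_zero {b : ℝ} (hb : b ≠ 0) {j n : ℤ} (h : j ≠ n) : freq b j - freq b n ≠ 0 := by
  rw [freq_sub]
  refine mul_ne_zero (mul_ne_zero (by exact_mod_cast hb) Complex.I_ne_zero) ?_
  rw [sub_ne_zero]
  exact_mod_cast h

lemma sq_norm_freq_sub_one (b : ℝ) (n : ℤ) : ‖freq b n - 1‖ ^ 2 = (b * n) ^ 2 + 1 := by
  rw [← Complex.normSq_eq_norm_sq, Complex.normSq_apply]
  simp only [freq, Complex.sub_re, Complex.sub_im, Complex.re_ofReal_mul, Complex.im_ofReal_mul,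
    Complex.I_re, Complex.I_im, Complex.one_re, Complex.one_im]
  ring

/-- The point `1` lies off the imaginary axis, so the resolvent of the diagonal operator exists
there even though the eigenvalue at `n = 0` vanishes. -/
lemma one_le_norm_freq_sub_one (b : ℝ) (n : ℤ) : 1 ≤ ‖freq b n - 1‖ := by
  have h := sq_norm_freq_sub_one b n
  nlinarith [sq_nonneg (b * n), norm_nonneg (freq b n - 1)]

lemma freq_sub_one_ne_zero (b : ℝ) (n : ℤ) : freq b n - 1 ≠ 0 := by
  have h := one_le_norm_freq_sub_one b n
  intro h0
  rw [h0, norm_zero] at h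
  linarith

lemma summable_sq_inv_int : Summable fun n : ℤ => ((n : ℝ) ^ 2)⁻¹ := by
  have := (Real.summable_one_div_int_pow (p := 2)).2 one_lt_two
  simpa using this

lemma summable_sq_inv_freq_sub_one {b : ℝ} (hb : b ≠ 0) :
    Summable fun n : ℤ => (‖freq b n - 1‖ ^ 2)⁻¹ := by
  rw [← (Set.finite_singleton (0 : ℤ)).summable_compl_iff]
  refine ((summable_sq_inv_int.mul_left (b ^ 2)⁻¹).subtype _).of_nonneg_of_le
    (fun n => inv_nonneg.2 (sq_nonneg _)) fun n => ?_
  have hn : ((n : ℤ) : ℝ) ≠ 0 := by exact_mod_cast n.2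
  simp only [Function.comp_apply]
  rw [← mul_inv, sq_norm_freq_sub_one]
  have : 0 < b ^ 2 * ((n : ℤ) : ℝ) ^ 2 := by positivity
  gcongr
  nlinarith

/-- The matrix of the model operator: `z` is the image of `x` under the diagonal operator with
eigenvalues `ibn` minus the Hankel operator with symbol `v`. -/
def IsModelImage (b : ℝ) (v : ℤ → H →L[ℂ] H) (x z : Seq2 H) : Prop :=
  (Summable fun n => ‖freq b n • x n‖ ^ 2) ∧
    ∀ j, z j = freq b j • x j - ∑' n, v (j + n) (x n)

/-- The solution of the commutator equation, before truncation. -/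
def commSol (b : ℝ) (v : ℤ → H →L[ℂ] H) (j n : ℤ) : H →L[ℂ] H :=
  (freq b j - freq b n)⁻¹ • v (j + n)

/-- The solution of the commutator equation, in the graph norm. -/
def commSolGraph (b : ℝ) (v : ℤ → H →L[ℂ] H) (j n : ℤ) : H →L[ℂ] H :=
  ((freq b j - 1) * (freq b n - 1)⁻¹) • commSol b v j n

/-- Removal of the finitely many entries in `F`. -/
def truncate (F : Finset (ℤ × ℤ)) (M : ℤ → ℤ → H →L[ℂ] H) (j n : ℤ) : H →L[ℂ] H :=
  if (j, n) ∈ F then 0 else M j n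

variable {v : ℤ → H →L[ℂ] H} {b : ℝ}

/-- In the variables `j + n` and `j - n` the squared norms factor into `‖v m‖²` and `(b²k²)⁻¹`. The
diagonal is the case `k = 0`, where the convention `0⁻¹ = 0` makes the entries vanish. -/
lemma isHS_commSol (hv : Summable fun n => ‖v n‖ ^ 2) (hb : b ≠ 0) : IsHS (commSol b v) := by
  have h1 := hv.mul_of_nonneg (summable_sq_inv_int.mul_left (b ^ 2)⁻¹)
    (fun n => sq_nonneg _) (fun n => by positivity)
  have hinj : Function.Injective fun p : ℤ × ℤ => (p.1 + p.2, p.1 - p.2) := by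
    rintro ⟨a, b⟩ ⟨c, d⟩ h
    simp only [Prod.mk.injEq] at h ⊢
    omega
  refine (h1.comp_injective hinj).congr fun p => ?_
  simp only [Function.comp_apply, commSol, norm_smul, freq_sub, norm_inv, norm_mul,
    Complex.norm_real, Complex.norm_I, Real.norm_eq_abs, mul_one]
  rw [mul_pow, mul_comm, inv_pow, mul_pow, sq_abs, mul_inv]
  congr 3
  rw [← Int.cast_sub, Complex.norm_intCast, sq_abs]

/-- This is the matrix of `B(A - 1)⁻¹`: the Hankel operator is bounded relative to the diagonal one.
-/
lemma isHS_smul_shift (hv : Summable fun n => ‖v n‖ ^ 2) (hb : b ≠ 0) :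
    IsHS fun j n => (freq b n - 1)⁻¹ • v (j + n) := by
  have h1 := hv.mul_of_nonneg (summable_sq_inv_freq_sub_one hb)
    (fun n => sq_nonneg _) (fun n => by positivity)
  have hinj : Function.Injective fun p : ℤ × ℤ => (p.1 + p.2, p.2) := by
    rintro ⟨a, b⟩ ⟨c, d⟩ h
    simp only [Prod.mk.injEq] at h ⊢
    omega
  refine (h1.comp_injective hinj).congr fun p => ?_
  simp only [Function.comp_apply, norm_smul, norm_inv]
  rw [mul_pow, mul_comm, inv_pow]

/-- Writing `(λⱼ - 1)/(λₙ - 1) = 1 + (λⱼ - λₙ)/(λₙ - 1)` for the eigenvalues, the second summand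
cancels the denominator of `commSol` and leaves `B(A - 1)⁻¹` off the diagonal. -/
lemma isHS_commSolGraph (hv : Summable fun n => ‖v n‖ ^ 2) (hb : b ≠ 0) :
    IsHS (commSolGraph b v) := by
  have h1 : IsHS fun j n => if j = n then (0 : H →L[ℂ] H) else (freq b n - 1)⁻¹ • v (j + n) :=
    (isHS_smul_shift hv hb).mono fun j n => by
      split_ifs
      · simp
      · exact le_rfl
  refine ((isHS_commSol hv hb).add h1).mono fun j n => le_of_eq ?_
  congr 1
  have hn := freq_sub_one_ne_zero b n
  split_ifs with h
  · subst h
    simp [commSolGraph, commSol]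
  · have h2 := freq_sub_ne_zero hb h
    rw [commSolGraph, commSol, smul_smul, ← add_smul]
    congr 1
    field_simp
    ring

lemma IsHS.truncate {M : ℤ → ℤ → H →L[ℂ] H} (hM : IsHS M) (F : Finset (ℤ × ℤ)) :
    IsHS (truncate F M) :=
  hM.mono fun j n => by
    unfold InvolutionProblem.truncate
    split_ifs
    · simp
    · exact le_rfl

/-- This is the remainder `R`. Its diagonal entries are `v (2n)`, and `F` contributes only finitely
many more. -/
lemma isHS_diagonal_union (hv : Summable fun n => ‖v n‖ ^ 2) (F : Finset (ℤ × ℤ)) :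
    IsHS fun j n => if j = n ∨ (j, n) ∈ F then v (j + n) else 0 := by
  have h1 : Summable fun p : ℤ × ℤ => if p.1 = p.2 then ‖v (p.1 + p.2)‖ ^ 2 else 0 := by
    have hinj : Function.Injective fun n : ℤ => (n, n) := fun m n h => (Prod.ext_iff.1 h).1
    rw [← hinj.summable_iff]
    · have h2 : Function.Injective fun n : ℤ => n + n := fun m n h => by
        simp only at h
        omega
      simpa [Function.comp_def] using hv.comp_injective h2
    · rintro ⟨j, n⟩ h
      simp only [mem_range, Prod.mk.injEq, not_exists, not_and] at h
      rw [if_neg fun h' => h j rfl h']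
  have h2 : Summable fun p : ℤ × ℤ => if p ∈ F then ‖v (p.1 + p.2)‖ ^ 2 else 0 :=
    summable_of_ne_finset_zero (s := F) fun p hp => if_neg hp
  refine (h1.add h2).of_nonneg_of_le (fun _ => sq_nonneg _) fun p => ?_
  beta_reduce
  by_cases h3 : p.1 = p.2
  · rw [if_pos (Or.inl h3), if_pos h3]
    have : 0 ≤ if p ∈ F then ‖v (p.1 + p.2)‖ ^ 2 else 0 := by split_ifs <;> positivity
    linarith
  · by_cases h4 : p ∈ F
    · simp [h3, h4]
    · simp [h3, h4]

variable [CompleteSpace H]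

/-- The norm is bounded by the tail of a convergent sum of squares. Stating it for all large `F`
lets one `F` serve two matrices. -/
lemma IsHS.eventually_norm_truncate_lt {M : ℤ → ℤ → H →L[ℂ] H} (hM : IsHS M) :
    ∀ᶠ F in (atTop : Filter (Finset (ℤ × ℤ))), ‖(hM.truncate F).toCLM‖ < 1 := by
  have h1 := (tendsto_tsum_compl_atTop_zero fun p : ℤ × ℤ => ‖M p.1 p.2‖ ^ 2).eventually
    (gt_mem_nhds (zero_lt_one (α := ℝ)))
  filter_upwards [h1] with F hF
  refine (hM.truncate F).norm_toCLM_le.trans_lt ?_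
  rw [Real.sqrt_lt' one_pos, one_pow]
  refine lt_of_eq_of_lt ?_ hF
  have h2 := tsum_subtype ({p | p ∉ F} : Set (ℤ × ℤ)) fun p : ℤ × ℤ => ‖M p.1 p.2‖ ^ 2
  refine Eq.trans ?_ h2.symm
  refine tsum_congr fun p => ?_
  by_cases hp : p ∈ F <;> simp [InvolutionProblem.truncate, indicator, hp]

/-- The product of the Hankel operator and the truncated solution of the commutator equation. -/
def hankelProd (b : ℝ) (v : ℤ → H →L[ℂ] H) (F : Finset (ℤ × ℤ)) (j l : ℤ) : H →L[ℂ] H :=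
  ∑' n, v (j + n) ∘L truncate F (commSol b v) n l

lemma IsHS.column {M : ℤ → ℤ → H →L[ℂ] H} (hM : IsHS M) (l : ℤ) :
    Summable fun n => ‖M n l‖ ^ 2 :=
  hM.comp_injective (i := fun n : ℤ => (n, l)) fun _ _ h => (Prod.ext_iff.1 h).1

lemma summable_sq_shift (hv : Summable fun n => ‖v n‖ ^ 2) (j : ℤ) :
    Summable fun n => ‖v (j + n)‖ ^ 2 :=
  hv.comp_injective (i := fun n => j + n) (add_right_injective j)

lemma summable_norm_hankel_comp (hv : Summable fun n => ‖v n‖ ^ 2) {M : ℤ → ℤ → H →L[ℂ] H}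
    (hM : IsHS M) (j l : ℤ) : Summable fun n => ‖v (j + n) ∘L M n l‖ :=
  (summable_mul_of_sq (fun _ => norm_nonneg _) (fun _ => norm_nonneg _)
    (summable_sq_shift hv j) (hM.column l)).of_nonneg_of_le (fun _ => norm_nonneg _)
    fun _ => ContinuousLinearMap.opNorm_comp_le _ _

/-- Without truncation the product is `-(ib)⁻¹` times the matrix of the second hypothesis. Each
entry of `F` removes a term living in a single column, where `‖v (j + m)‖²` is summable over `j`. -/
lemma isHS_hankelProd (hv : Summable fun n => ‖v n‖ ^ 2) (hb : b ≠ 0)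
    (h2 : Summable fun p : ℤ × ℤ => ‖∑' n : {n : ℤ // n ≠ p.2},
      ((p.2 : ℂ) - ((n : ℤ) : ℂ))⁻¹ • (v (p.1 + n) ∘L v (p.2 + n))‖ ^ 2)
    (F : Finset (ℤ × ℤ)) : IsHS (hankelProd b v F) := by
  have hHS := isHS_commSol hv hb
  have hfull : IsHS fun j l => ∑' n, v (j + n) ∘L commSol b v n l := by
    have h3 : IsHS fun j l => ∑' n : {n : ℤ // n ≠ l},
      ((l : ℂ) - ((n : ℤ) : ℂ))⁻¹ • (v (j + n) ∘L v (l + n)) := h2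
    refine (h3.const_smul (-(b * Complex.I)⁻¹)).mono fun j l => le_of_eq ?_
    congr 1
    have h4 := tsum_subtype ({n | n ≠ l} : Set ℤ)
      fun n => ((l : ℂ) - (n : ℂ))⁻¹ • (v (j + n) ∘L v (l + n))
    have h5 : ∀ n, v (j + n) ∘L commSol b v n l = (-(b * Complex.I)⁻¹) •
        indicator {n | n ≠ l} (fun n => ((l : ℂ) - (n : ℂ))⁻¹ • (v (j + n) ∘L v (l + n))) n := by
      intro n
      by_cases hn : n = l
      · simp [indicator, hn, commSol]
      · rw [indicator_of_mem (show n ∈ {n | n ≠ l} from hn), commSol, freq_sub, smul_smul,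
          ContinuousLinearMap.comp_smul, add_comm n l]
        congr 1
        rw [mul_inv, neg_mul, ← mul_neg, ← inv_neg, neg_sub]
    rw [tsum_congr h5, tsum_const_smul'']
    exact congrArg _ h4.symm
  have hfin : IsHS fun j l => ∑ p ∈ F,
      if p.2 = l then v (j + p.1) ∘L commSol b v p.1 p.2 else 0 := by
    refine IsHS.sum F fun p _ => ?_
    have h3 : Summable fun l : ℤ => if p.2 = l then (1 : ℝ) else 0 :=
      summable_of_ne_finset_zero (s := {p.2}) fun l hl => by
        rw [if_neg]; simpa [eq_comm] using hl
    have h4 : Summable fun j => ‖v (j + p.1) ∘L commSol b v p.1 p.2‖ ^ 2 := by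
      refine ((hv.comp_injective (i := fun j => j + p.1)
        (add_left_injective p.1)).mul_right (‖commSol b v p.1 p.2‖ ^ 2)).of_nonneg_of_le
        (fun _ => sq_nonneg _) fun j => ?_
      rw [Function.comp_apply, ← mul_pow]
      gcongr
      exact ContinuousLinearMap.opNorm_comp_le _ _
    refine (h4.mul_of_nonneg h3 (fun _ => sq_nonneg _) fun l => ?_).congr fun q => ?_
    · simp only [Pi.zero_apply]
      split_ifs <;> norm_num
    · by_cases h : p.2 = q.2 <;> simp [h]
  refine (hfull.sub hfin).mono fun j l => le_of_eq ?_
  congr 1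
  rw [eq_sub_iff_add_eq, hankelProd]
  have h6 : ∀ p ∈ F, HasSum (fun n => if p = (n, l) then v (j + p.1) ∘L commSol b v p.1 p.2 else 0)
      (if p.2 = l then v (j + p.1) ∘L commSol b v p.1 p.2 else 0) := by
    rintro ⟨m, k⟩ -
    convert hasSum_ite_eq m (if k = l then v (j + m) ∘L commSol b v m k else 0) using 2 with n
    simp only [Prod.mk.injEq]
    grind
  have h7 := (summable_norm_hankel_comp hv (hHS.truncate F) j l).of_norm.hasSum.add
    (hasSum_sum h6)
  rw [← h7.tsum_eq]
  refine tsum_congr fun n => ?_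
  rw [Finset.sum_ite_eq']
  by_cases hn : (n, l) ∈ F <;> simp [truncate, hn]

/-- Composition of the Hankel operator with the truncated solution of the commutator equation. -/
lemma hankel_apply_commSol (hv : Summable fun n => ‖v n‖ ^ 2) (hb : b ≠ 0)
    (F : Finset (ℤ × ℤ)) (x : Seq2 H) (j : ℤ) :
    ∑' n, v (j + n) (((isHS_commSol hv hb).truncate F).toCLM x n) =
      ∑' l, hankelProd b v F j l (x l) := by
  have hHS := (isHS_commSol hv hb).truncate F
  -- Since `B` need not be bounded, the product is computed row by row. The double series converges
  -- absolutely by Cauchy–Schwarz on `ℤ × ℤ`, pairing the entries of `Γ` with `‖v (j + n)‖ ‖x l‖`.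
  have h1 : Summable fun p : ℤ × ℤ => v (j + p.1) (truncate F (commSol b v) p.1 p.2 (x p.2)) := by
    have h2 : Summable fun p : ℤ × ℤ => (‖v (j + p.1)‖ * ‖x p.2‖) ^ 2 := by
      simpa only [mul_pow] using (summable_sq_shift hv j).mul_of_nonneg x.summable
        (fun _ => sq_nonneg _) (fun _ => sq_nonneg _)
    refine Summable.of_norm_bounded (summable_mul_of_sq
      (fun p : ℤ × ℤ => norm_nonneg (truncate F (commSol b v) p.1 p.2))
      (fun p => by positivity) hHS h2) fun p => ?_
    calc _ ≤ ‖v (j + p.1)‖ * (‖truncate F (commSol b v) p.1 p.2‖ * ‖x p.2‖) :=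
          (v (j + p.1)).le_opNorm_of_le ((truncate F (commSol b v) p.1 p.2).le_opNorm _)
      _ = _ := by ring
  have h3 := Summable.tsum_comm (f := fun n l => v (j + n) (truncate F (commSol b v) n l (x l))) h1
  calc _ = ∑' n, ∑' l, v (j + n) (truncate F (commSol b v) n l (x l)) :=
        tsum_congr fun n => by
          rw [IsHS.toCLM_apply, (v (j + n)).map_tsum (summable_row_apply (hHS.row n) x).of_norm]
    _ = ∑' l, ∑' n, v (j + n) (truncate F (commSol b v) n l (x l)) := h3.symm
    _ = _ := tsum_congr fun l => by
          rw [hankelProd]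
          exact ((ContinuousLinearMap.apply ℂ H (x l)).map_tsum
            (summable_norm_hankel_comp hv hHS j l).of_norm).symm

/-- These are the entries of `AΓ - ΓA = B - R`. -/
lemma smul_truncate_commSol (hb : b ≠ 0) (F : Finset (ℤ × ℤ)) (j n : ℤ) :
    (freq b j - freq b n) • truncate F (commSol b v) j n =
      v (j + n) - if j = n ∨ (j, n) ∈ F then v (j + n) else 0 := by
  by_cases h1 : (j, n) ∈ F
  · simp [truncate, h1]
  · by_cases h2 : j = n
    · simp [h2]
    · rw [truncate, if_neg h1, commSol, smul_inv_smul₀ (freq_sub_ne_zero hb h2),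
        if_neg (by simp [h1, h2]), sub_zero]

/-- The commutator equation on the domain of the diagonal operator. -/
lemma freq_smul_commSol (hv : Summable fun n => ‖v n‖ ^ 2) (hb : b ≠ 0) (F : Finset (ℤ × ℤ))
    {x w : Seq2 H} (hw : ∀ n, w n = freq b n • x n) (j : ℤ) :
    freq b j • ((isHS_commSol hv hb).truncate F).toCLM x j =
      ((isHS_commSol hv hb).truncate F).toCLM w j + ∑' n, v (j + n) (x n) -
        (isHS_diagonal_union hv F).toCLM x j := by
  have hHS := (isHS_commSol hv hb).truncate F
  simp only [IsHS.toCLM_apply]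
  have s1 := (summable_row_apply (hHS.row j) x).of_norm
  have s2 := (summable_row_apply (hHS.row j) w).of_norm
  have s3 := (summable_row_apply (summable_sq_shift hv j) x).of_norm
  have s4 := (summable_row_apply ((isHS_diagonal_union hv F).row j) x).of_norm
  rw [← s1.tsum_const_smul, ← s2.tsum_add s3, ← (s2.add s3).tsum_sub s4]
  refine tsum_congr fun n => ?_
  have h1 := congrArg (fun A : H →L[ℂ] H => A (x n)) (smul_truncate_commSol (v := v) hb F j n)
  simp only [smul_apply, sub_apply, sub_smul] at h1
  rw [hw, map_smul, add_sub_assoc, ← h1]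
  abel

/-- The solution of the commutator equation acts on the domain of the diagonal operator. -/
lemma freq_sub_one_smul_commSol (hv : Summable fun n => ‖v n‖ ^ 2) (hb : b ≠ 0)
    (F : Finset (ℤ × ℤ)) {x u : Seq2 H} (hu : ∀ n, u n = (freq b n - 1) • x n) (j : ℤ) :
    (freq b j - 1) • ((isHS_commSol hv hb).truncate F).toCLM x j =
      ((isHS_commSolGraph hv hb).truncate F).toCLM u j := by
  simp only [IsHS.toCLM_apply]
  rw [← (summable_row_apply (((isHS_commSol hv hb).truncate F).row j) x).of_norm.tsum_const_smul]
  refine tsum_congr fun n => ?_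
  rw [hu, map_smul]
  by_cases h : (j, n) ∈ F
  · simp [truncate, h]
  · simp only [truncate, h, if_false, commSolGraph, smul_apply, smul_smul]
    congr 1
    field_simp [freq_sub_one_ne_zero b n]

/-- Multiplication by the resolvent `(ibn - 1)⁻¹` of the diagonal operator. -/
lemma exists_freq_sub_one_smul_eq (b : ℝ) (u : Seq2 H) :
    ∃ x : Seq2 H, ∀ n, u n = (freq b n - 1) • x n := by
  have h1 : Memℓp (fun n => (freq b n - 1)⁻¹ • u n) 2 := by
    refine memℓp_two_iff.2 (u.summable.of_nonneg_of_le (fun _ => sq_nonneg _) fun n => ?_)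
    rw [norm_smul, norm_inv]
    gcongr
    exact mul_le_of_le_one_left (norm_nonneg _)
      (inv_le_one_of_one_le₀ (one_le_norm_freq_sub_one b n))
  exact ⟨⟨_, h1⟩, fun n => (smul_inv_smul₀ (freq_sub_one_ne_zero b n) _).symm⟩

lemma exists_equiv_one_add {Y : Type*} [NormedAddCommGroup Y] [NormedSpace ℂ Y] [CompleteSpace Y]
    {S : Y →L[ℂ] Y} (hS : ‖S‖ < 1) : ∃ e : Y ≃L[ℂ] Y, ∀ y, e y = y + S y := by
  have h1 : ‖-S‖ < 1 := by rwa [norm_neg]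
  refine ⟨ContinuousLinearEquiv.unitsEquiv ℂ Y (Units.oneSub (-S) h1), fun y => ?_⟩
  rw [ContinuousLinearEquiv.unitsEquiv_apply, Units.val_oneSub]
  simp

/-- The model operator generates a strongly continuous group. -/
theorem exists_modelGroup (hv : Summable fun n => ‖v n‖ ^ 2) (hb : b ≠ 0)
    (h2 : Summable fun p : ℤ × ℤ => ‖∑' n : {n : ℤ // n ≠ p.2},
      ((p.2 : ℂ) - ((n : ℤ) : ℂ))⁻¹ • (v (p.1 + n) ∘L v (p.2 + n))‖ ^ 2) :
    ∃ T : ℝ → Seq2 H →L[ℂ] Seq2 H, IsC0Group T ∧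
      ∀ x z, HasOrbitDeriv T x z ↔ IsModelImage b v x z := by
  -- A single `F` makes both `P = 1 + Γ` and `P' = 1 + Γ'` invertible, where `P'(A - 1) = (A - 1)P`
  -- on the domain of `A`.
  obtain ⟨F, hF, hF'⟩ := ((isHS_commSol hv hb).eventually_norm_truncate_lt.and
    (isHS_commSolGraph hv hb).eventually_norm_truncate_lt).exists
  obtain ⟨P, hP⟩ := exists_equiv_one_add hF
  obtain ⟨P', hP'⟩ := exists_equiv_one_add hF'
  set Γ := ((isHS_commSol hv hb).truncate F).toCLM with hΓ
  set Γ' := ((isHS_commSolGraph hv hb).truncate F).toCLM with hΓ'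
  set R := (isHS_diagonal_union hv F).toCLM with hR
  set K := (isHS_hankelProd hv hb h2 F).toCLM with hK
  have hKapp : ∀ x j, ∑' n, v (j + n) (Γ x n) = K x j := fun x j =>
    hankel_apply_commSol hv hb F x j
  have hdom : ∀ x : Seq2 H, (Summable fun n => ‖freq b n • x n‖ ^ 2) ↔
      ∃ w : Seq2 H, ∀ n, w n = freq b n • x n := by
    refine fun x => ⟨fun h => ⟨⟨_, memℓp_two_iff.2 h⟩, fun n => rfl⟩, ?_⟩
    rintro ⟨w, hw⟩
    simpa only [hw] using w.summable
  have hdomP : ∀ x : Seq2 H, (∃ w : Seq2 H, ∀ n, w n = freq b n • P x n) ↔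
      ∃ w : Seq2 H, ∀ n, w n = freq b n • x n := by
    intro x
    constructor
    · rintro ⟨w, hw⟩
      -- When `P x` is in the domain, `x' = (A - 1)⁻¹ P'⁻¹ (A - 1) P x` lies there too and satisfies
      -- `P x' = P x`, whence `x' = x`.
      obtain ⟨x', hx'⟩ := exists_freq_sub_one_smul_eq b (P'.symm (w - P x))
      have h3 : P x' = P x := by
        ext n
        refine smul_right_injective H (freq_sub_one_ne_zero b n) ?_
        have h4 := freq_sub_one_smul_commSol hv hb F hx' n
        have h5 := congrArg (fun y : Seq2 H => y n) (P'.apply_symm_apply (w - P x))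
        simp only [hP', lp.coeFn_add, lp.coeFn_sub, Pi.add_apply, Pi.sub_apply, hw] at h5
        simp only
        rw [hP x', lp.coeFn_add, Pi.add_apply, smul_add, h4, ← hx', ← hΓ', h5, sub_smul, one_smul]
      obtain rfl := P.injective h3
      refine ⟨P'.symm (w - P x') + x', fun n => ?_⟩
      rw [lp.coeFn_add, Pi.add_apply, hx', sub_smul, one_smul, sub_add_cancel]
    · rintro ⟨w, hw⟩
      have h4 : ∀ n, (w - x) n = (freq b n - 1) • x n := fun n => by
        rw [lp.coeFn_sub, Pi.sub_apply, hw, sub_smul, one_smul]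
      -- With `w = Ax`, one has `AΓx = Γx + (A - 1)Γx = Γx + Γ'(A - 1)x`.
      refine ⟨w + Γ x + Γ' (w - x), fun n => ?_⟩
      have h5 := freq_sub_one_smul_commSol hv hb F h4 n
      rw [← hΓ, ← hΓ'] at h5
      simp only [lp.coeFn_add, Pi.add_apply, hP, smul_add, ← h5, sub_smul, one_smul, hw]
      abel
  obtain ⟨T, hT, hTgen⟩ := exists_perturbedGroup (isC0Group_diagGroup (H := H)
    (a := fun n => b * n)) norm_diagGroup_le (-((P.symm : Seq2 H →L[ℂ] Seq2 H) ∘L (R + K)))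
  refine ⟨_, hT.conj P.symm, fun y q => ?_⟩
  rw [hasOrbitDeriv_conj, hTgen, hasOrbitDeriv_diagGroup]
  obtain ⟨x, rfl⟩ := P.surjective y
  obtain ⟨z, rfl⟩ := P.surjective q
  rw [IsModelImage, hdom, hdomP, P.symm_apply_apply, P.symm_apply_apply]
  have hD : ∀ w : Seq2 H, (∀ n, w n = freq b n • x n) →
      ((∀ j, P z j = freq b j • P x j - ∑' n, v (j + n) (P x n)) ↔
        z - (-((P.symm : Seq2 H →L[ℂ] Seq2 H) ∘L (R + K))) x = w) := by
    intro w hw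
    -- The intertwining identity `(A - B)P x = P A x - (R + K) x`; the two occurrences of `Bx`
    -- cancel by the commutator equation.
    have h3 : ∀ j, freq b j • P x j - ∑' n, v (j + n) (P x n) = (P w - (R + K) x) j := by
      intro j
      have h4 := freq_smul_commSol hv hb F hw j
      rw [← hΓ, ← hR] at h4
      have s1 := (summable_row_apply (summable_sq_shift hv j) x).of_norm
      have s2 := (summable_row_apply (summable_sq_shift hv j) (Γ x)).of_norm
      simp only [hP, lp.coeFn_add, lp.coeFn_sub, Pi.add_apply, Pi.sub_apply, map_add, smul_add,
        add_apply]
      rw [s1.tsum_add s2, hKapp, h4, hw]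
      abel
    simp only [h3]
    constructor
    · intro h
      have h5 : P z = P w - (R + K) x := lp.ext (funext h)
      have h6 := congrArg P.symm h5
      rw [map_sub, P.symm_apply_apply, P.symm_apply_apply] at h6
      rw [h6, neg_apply, sub_neg_eq_add]
      exact sub_add_cancel _ _
    · intro h j
      rw [← h]
      simp
      abel
  constructor
  · intro h
    exact ⟨⟨_, h⟩, (hD _ h).2 rfl⟩
  · rintro ⟨⟨w, hw⟩, h⟩ n
    rw [(hD w hw).1 h, hw]
    rfl

end Similarity

/-! ### The Fourier transform on `L²([0, ω], H)`. -/

section Fourier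

variable {H : Type*} [NormedAddCommGroup H] [InnerProductSpace ℂ H] {ω : ℝ}

lemma expNeg_eq_phase (ω : ℝ) (n : ℤ) : expNeg ω n = phase (-(2 * Real.pi / ω * n)) := by
  ext s
  rw [expNeg, phase]
  congr 2
  push_cast
  ring

lemma continuous_expNeg (ω : ℝ) (n : ℤ) : Continuous (expNeg ω n) := by
  rw [expNeg_eq_phase]
  exact continuous_phase _

lemma expNeg_at_zero (ω : ℝ) (n : ℤ) : expNeg ω n 0 = 1 := by
  rw [expNeg_eq_phase, phase_zero]

lemma expNeg_zero (ω s : ℝ) : expNeg ω 0 s = 1 := by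
  simp [expNeg]

lemma expNeg_add (ω : ℝ) (m n : ℤ) (s : ℝ) :
    expNeg ω (m + n) s = expNeg ω m s * expNeg ω n s := by
  rw [expNeg, expNeg, expNeg, ← Complex.exp_add]
  congr 1
  push_cast
  ring

lemma conj_expNeg (ω : ℝ) (n : ℤ) (s : ℝ) :
    starRingEnd ℂ (expNeg ω n s) = expNeg ω (-n) s := by
  rw [expNeg, expNeg, ← Complex.exp_conj]
  congr 1
  rw [map_mul, map_neg, Complex.conj_ofReal, Complex.conj_I]
  push_cast
  ring

lemma expNeg_period (hω : 0 < ω) (n : ℤ) : expNeg ω n ω = 1 := by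
  have h := Complex.exp_int_mul_two_pi_mul_I (-n)
  rw [expNeg, ← h]
  congr 1
  have : (ω : ℂ) ≠ 0 := by exact_mod_cast hω.ne'
  push_cast
  field_simp

/-- This is the reason the potential term has a matrix depending on `j + n` instead of `j - n`. -/
lemma expNeg_reflect (hω : 0 < ω) (n : ℤ) (s : ℝ) : expNeg ω (-n) (ω - s) = expNeg ω n s := by
  have h1 : expNeg ω (-n) (ω - s) = expNeg ω (-n) ω * expNeg ω n s := by
    rw [expNeg, expNeg, expNeg, ← Complex.exp_add]
    congr 1
    push_cast
    ring
  rw [h1, expNeg_period hω, one_mul]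

lemma freq_mul_integral_expNeg (ω : ℝ) (n : ℤ) (r t : ℝ) :
    freq (2 * Real.pi / ω) n * ∫ s in r..t, expNeg ω n s = expNeg ω n r - expNeg ω n t := by
  rw [← intervalIntegral.integral_const_mul,
    intervalIntegral.integral_eq_sub_of_hasDerivAt (f := fun s => -expNeg ω n s)]
  · ring
  · intro s _
    rw [expNeg_eq_phase]
    refine (hasDerivAt_phase _ s).neg.congr_deriv ?_
    rw [freq]
    push_cast
    ring
  · exact (continuous_const.mul (continuous_expNeg ω n)).intervalIntegrable _ _

lemma setIntegral_Icc_eq (hω : 0 < ω) {E : Type*} [NormedAddCommGroup E] [NormedSpace ℝ E]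
    (f : ℝ → E) : ∫ s in Icc (0 : ℝ) ω, f s = ∫ s in (0 : ℝ)..ω, f s := by
  rw [integral_Icc_eq_integral_Ioc, intervalIntegral.integral_of_le hω.le]

lemma two_pi_div_ne_zero (hω : 0 < ω) : 2 * Real.pi / ω ≠ 0 := by
  have := Real.pi_pos
  positivity

lemma freq_zero (b : ℝ) : freq b 0 = 0 := by simp [freq]

lemma freq_ne_zero {b : ℝ} (hb : b ≠ 0) {n : ℤ} (hn : n ≠ 0) : freq b n ≠ 0 := by
  have := freq_sub_ne_zero hb hn
  rwa [freq_zero, sub_zero] at this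

lemma integral_expNeg (hω : 0 < ω) (n : ℤ) :
    ∫ s in Icc (0 : ℝ) ω, expNeg ω n s = if n = 0 then (ω : ℂ) else 0 := by
  rw [setIntegral_Icc_eq hω]
  split_ifs with h
  · subst h
    simp [expNeg_zero]
  · have h1 := freq_mul_integral_expNeg ω n 0 ω
    rw [expNeg_at_zero, expNeg_period hω, sub_self] at h1
    exact (mul_eq_zero.1 h1).resolve_left (freq_ne_zero (two_pi_div_ne_zero hω) h)

/-- The Fourier coefficient of a function on `[0, ω]` with values in `H`. -/
def coeff (ω : ℝ) (n : ℤ) (f : ℝ → H) : H :=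
  (ω : ℂ)⁻¹ • ∫ s in Icc (0 : ℝ) ω, expNeg ω n s • f s

lemma coeff_congr {f g : ℝ → H} (n : ℤ) (h : f =ᵐ[volume.restrict (Icc (0 : ℝ) ω)] g) :
    coeff ω n f = coeff ω n g := by
  rw [coeff, coeff]
  congr 1
  refine integral_congr_ae ?_
  filter_upwards [h] with s hs
  rw [hs]

variable [CompleteSpace H]

lemma coeff_add {f g : ℝ → H} (n : ℤ) (hf : MemLp f 2 (volume.restrict (Icc (0 : ℝ) ω)))
    (hg : MemLp g 2 (volume.restrict (Icc (0 : ℝ) ω))) :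
    coeff ω n (fun s => f s + g s) = coeff ω n f + coeff ω n g := by
  rw [coeff, coeff, coeff, ← smul_add, ← integral_add (integrable_expNeg_smul hf n)
    (integrable_expNeg_smul hg n)]
  simp only [smul_add]

lemma coeff_sub {f g : ℝ → H} (n : ℤ) (hf : MemLp f 2 (volume.restrict (Icc (0 : ℝ) ω)))
    (hg : MemLp g 2 (volume.restrict (Icc (0 : ℝ) ω))) :
    coeff ω n (fun s => f s - g s) = coeff ω n f - coeff ω n g := by
  rw [coeff, coeff, coeff, ← smul_sub, ← integral_sub (integrable_expNeg_smul hf n)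
    (integrable_expNeg_smul hg n)]
  simp only [smul_sub]

lemma coeff_const (hω : 0 < ω) (x : H) : coeff ω 0 (fun _ => x) = x := by
  have h : (ω : ℂ) ≠ 0 := by exact_mod_cast hω.ne'
  rw [coeff, integral_smul_const, integral_expNeg hω, if_pos rfl, inv_smul_smul₀ h]

/-- A scalar function all of whose Fourier coefficients vanish is zero. -/
lemma ae_eq_zero_of_coeff_scalar (hω : 0 < ω) {f : ℝ → ℂ}
    (hf : MemLp f 2 (volume.restrict (Icc (0 : ℝ) ω)))
    (h : ∀ n, ∫ s in Icc (0 : ℝ) ω, expNeg ω n s • f s = 0) :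
    f =ᵐ[volume.restrict (Icc (0 : ℝ) ω)] 0 := by
  have hf' : MemLp f 2 (volume.restrict (Ioc (0 : ℝ) ω)) := by
    rwa [Measure.restrict_congr_set Ioc_ae_eq_Icc]
  -- By Parseval, vanishing coefficients force `∫ ‖f‖² = 0`.
  have h1 := hasSum_sq_fourierCoeffOn hω hf'
  have h2 : ∀ n, fourierCoeffOn hω f n = 0 := by
    intro n
    rw [fourierCoeffOn_eq_integral]
    have h3 : ∫ x in (0 : ℝ)..ω, fourier (-n) (x : AddCircle (ω - 0)) • f x = 0 := by
      rw [← h n, setIntegral_Icc_eq hω]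
      refine intervalIntegral.integral_congr fun s _ => ?_
      simp only [fourier_coe_apply, expNeg]
      congr 2
      push_cast
      ring
    rw [h3, smul_zero]
  simp only [h2, norm_zero, ne_eq, OfNat.ofNat_ne_zero, not_false_eq_true, zero_pow] at h1
  have h4 := h1.unique hasSum_zero
  rw [smul_eq_zero, ← setIntegral_Icc_eq hω] at h4
  have h5 := h4.resolve_left (inv_ne_zero (by simpa using hω.ne'))
  rw [integral_eq_zero_iff_of_nonneg (fun s => sq_nonneg _)
    ((memLp_two_iff_integrable_sq_norm hf.1).1 hf)] at h5
  filter_upwards [h5] with s hs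
  simpa using hs

/-- An element of `L²([0, ω], H)` all of whose Fourier coefficients vanish is zero. -/
lemma eq_zero_of_coeff (hω : 0 < ω) {y : L2 ω H} (h : ∀ n, coeff ω n y = 0) : y = 0 := by
  have hω' : (ω : ℂ) ≠ 0 := by exact_mod_cast hω.ne'
  have h0 : ∀ n, ∫ s in Icc (0 : ℝ) ω, expNeg ω n s • y s = 0 := fun n =>
    (smul_eq_zero.1 (h n)).resolve_left (inv_ne_zero hω')
  have hx : ∀ x : H, (fun s => inner ℂ x (y s)) =ᵐ[volume.restrict (Icc (0 : ℝ) ω)] 0 := by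
    intro x
    refine ae_eq_zero_of_coeff_scalar hω ((Lp.memLp y).const_inner x) fun n => ?_
    have h1 := integral_inner (𝕜 := ℂ) (integrable_expNeg_smul (Lp.memLp y) n) x
    rw [h0 n, inner_zero_right] at h1
    rw [← h1]
    simp only [inner_smul_right, smul_eq_mul]
  apply Lp.ext
  refine EventuallyEq.trans ?_ (Lp.coeFn_zero _ _ _).symm
  -- The null set in `hx` depends on `x`, and `H` may be nonseparable. Integrals over measurable
  -- sets are tested against each `x` separately, so no common null set is needed.
  refine Lp.ae_eq_zero_of_forall_setIntegral_eq_zero y (by norm_num) (by norm_num)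
    (fun s _ _ => (L2.integrable y).integrableOn) fun s _ _ => ?_
  refine ext_inner_left ℂ fun x => ?_
  rw [inner_zero_right, ← integral_inner (L2.integrable y).integrableOn]
  rw [integral_congr_ae (ae_restrict_of_ae (hx x))]
  simp

lemma memLp_expNeg_smul (ω : ℝ) (n : ℤ) (x : H) :
    MemLp (fun s => expNeg ω n s • x) 2 (volume.restrict (Icc (0 : ℝ) ω)) :=
  MemLp.of_bound ((continuous_expNeg ω n).smul continuous_const).aestronglyMeasurable ‖x‖
    (.of_forall fun s => by rw [norm_smul, norm_expNeg, one_mul])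

/-- The function `s ↦ e^{2πins/ω} x`, as an element of `L²([0, ω], H)`. -/
def trig (ω : ℝ) (n : ℤ) : H →ₗ[ℂ] L2 ω H where
  toFun x := (memLp_expNeg_smul ω (-n) x).toLp _
  map_add' x y := by
    rw [← MemLp.toLp_add]
    exact MemLp.toLp_congr _ _ (.of_forall fun s => by simp)
  map_smul' c x := by
    rw [RingHom.id_apply, ← MemLp.toLp_const_smul]
    exact MemLp.toLp_congr _ _ (.of_forall fun s => by simp [smul_comm c])

lemma coeFn_trig (n : ℤ) (x : H) :
    trig ω n x =ᵐ[volume.restrict (Icc (0 : ℝ) ω)] fun s => expNeg ω (-n) s • x :=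
  (memLp_expNeg_smul ω (-n) x).coeFn_toLp

lemma inner_trig (hω : 0 < ω) (n : ℤ) (x : H) (y : L2 ω H) :
    inner ℂ (trig ω n x) y = (ω : ℂ) * inner ℂ x (coeff ω n y) := by
  have hω' : (ω : ℂ) ≠ 0 := by exact_mod_cast hω.ne'
  rw [coeff, inner_smul_right, mul_inv_cancel_left₀ hω', MeasureTheory.L2.inner_def,
    ← integral_inner (integrable_expNeg_smul (Lp.memLp y) n)]
  refine integral_congr_ae ?_
  filter_upwards [coeFn_trig n x] with s hs
  rw [hs, inner_smul_left, inner_smul_right, conj_expNeg, neg_neg]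

lemma coeff_trig (hω : 0 < ω) (m n : ℤ) (x : H) :
    coeff ω m (trig ω n x) = if m = n then x else 0 := by
  have hω' : (ω : ℂ) ≠ 0 := by exact_mod_cast hω.ne'
  rw [coeff_congr m (coeFn_trig n x), coeff]
  simp only [smul_smul, ← expNeg_add]
  rw [integral_smul_const, integral_expNeg hω]
  by_cases h : m = n
  · rw [if_pos (by omega), if_pos h, inv_smul_smul₀ hω']
  · rw [if_neg (by omega), if_neg h, zero_smul, smul_zero]

/-- The vector-valued Fourier transform `L²([0, ω], H) ≃ ℓ²(ℤ, H)`. -/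
lemma exists_fourierEquiv (hω : 0 < ω) :
    ∃ U : L2 ω H ≃L[ℂ] Seq2 H, ∀ y n, U y n = coeff ω n y := by
  have hω' : (ω : ℂ) ≠ 0 := by exact_mod_cast hω.ne'
  have hs : 0 < √ω := Real.sqrt_pos.2 hω
  have hs' : ((√ω : ℝ) : ℂ) ≠ 0 := by exact_mod_cast hs.ne'
  have hss : ((√ω : ℝ) : ℂ) * (√ω : ℝ) = ω := by exact_mod_cast Real.mul_self_sqrt hω.le
  have hinner : ∀ m n (x y : H), inner ℂ (trig ω m x) (trig ω n y) =
      if m = n then (ω : ℂ) * inner ℂ x y else 0 := by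
    intro m n x y
    rw [inner_trig hω, coeff_trig hω]
    split_ifs <;> simp
  let W : ℤ → H →ₗᵢ[ℂ] L2 ω H := fun n =>
    { toLinearMap := ((√ω : ℝ) : ℂ)⁻¹ • trig ω n
      norm_map' := fun x => by
        rw [LinearMap.smul_apply, norm_smul, norm_inv, Complex.norm_real,
          Real.norm_of_nonneg hs.le]
        have h1 : ‖trig ω n x‖ = √ω * ‖x‖ := by
          rw [← sq_eq_sq₀ (norm_nonneg _) (by positivity), mul_pow, Real.sq_sqrt hω.le,
            ← inner_self_eq_norm_sq (𝕜 := ℂ), ← inner_self_eq_norm_sq (𝕜 := ℂ), hinner, if_pos rfl]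
          exact Complex.re_ofReal_mul _ _
        rw [h1, inv_mul_cancel_left₀ hs.ne'] }
  have hW : ∀ n x, W n x = ((√ω : ℝ) : ℂ)⁻¹ • trig ω n x := fun n x => rfl
  have hortho : OrthogonalFamily ℂ (fun _ : ℤ => H) W := fun m n hmn x y => by
    simp only
    rw [hW, hW, inner_smul_left, inner_smul_right, hinner, if_neg hmn, mul_zero, mul_zero]
  have hsum : IsHilbertSum ℂ (fun _ : ℤ => H) W := by
    refine IsHilbertSum.mk hortho (top_le_iff.2 ?_)
    rw [Submodule.topologicalClosure_eq_top_iff, Submodule.eq_bot_iff]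
    intro y hy
    refine eq_zero_of_coeff hω fun n => ext_inner_left ℂ fun x => ?_
    have h1 := (Submodule.mem_orthogonal _ _).1 hy (W n x)
      ((le_iSup (fun n => LinearMap.range (W n).toLinearMap) n) ⟨x, rfl⟩)
    rw [hW, inner_smul_left, inner_trig hω, mul_eq_zero, mul_eq_zero] at h1
    rw [inner_zero_right]
    exact (h1.resolve_left (by simpa using hs.ne')).resolve_left hω'
  have hcoeff : ∀ y n, hsum.linearIsometryEquiv y n = ((√ω : ℝ) : ℂ) • coeff ω n y := by
    intro y n
    refine ext_inner_left ℂ fun x => ?_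
    have h1 := hsum.linearIsometryEquiv.symm.inner_map_map (lp.single 2 n x)
      (hsum.linearIsometryEquiv y)
    rw [LinearIsometryEquiv.symm_apply_apply, hsum.linearIsometryEquiv_symm_apply_single,
      lp.inner_single_left, hW, inner_smul_left, inner_trig hω, ← hss] at h1
    rw [← h1, inner_smul_right, map_inv₀, Complex.conj_ofReal, mul_assoc, inv_mul_cancel_left₀ hs']
  -- The isometry has coordinates `√ω • coeff ω n y`; the rescaling gives the coefficients
  -- normalized by `1/ω`.
  refine ⟨hsum.linearIsometryEquiv.toContinuousLinearEquiv.trans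
    (ContinuousLinearEquiv.smulLeft (Units.mk0 _ (inv_ne_zero hs'))), fun y n => ?_⟩
  change ((√ω : ℝ) : ℂ)⁻¹ • hsum.linearIsometryEquiv y n = _
  rw [hcoeff, inv_smul_smul₀ hs']

end Fourier

/-! ### `L` in Fourier coordinates. -/

section SobolevCoefficients

variable {H : Type*} [NormedAddCommGroup H] [InnerProductSpace ℂ H] [CompleteSpace H] {ω : ℝ}

lemma ae_eq_of_coeff_eq (hω : 0 < ω) {f g : ℝ → H}
    (hf : MemLp f 2 (volume.restrict (Icc (0 : ℝ) ω)))
    (hg : MemLp g 2 (volume.restrict (Icc (0 : ℝ) ω)))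
    (h : ∀ n, coeff ω n f = coeff ω n g) : f =ᵐ[volume.restrict (Icc (0 : ℝ) ω)] g := by
  have h1 : (hf.sub hg).toLp _ = 0 := eq_zero_of_coeff hω fun n => by
    rw [coeff_congr n (hf.sub hg).coeFn_toLp]
    exact (coeff_sub n hf hg).trans (sub_eq_zero.2 (h n))
  have h2 := (hf.sub hg).coeFn_toLp
  rw [h1] at h2
  filter_upwards [h2, Lp.coeFn_zero H 2 (volume.restrict (Icc (0 : ℝ) ω))] with s h3 h4
  rw [h4] at h3
  exact (sub_eq_zero.1 h3.symm)

lemma memLp_of_continuousOn {f : ℝ → H} (hf : ContinuousOn f (Icc 0 ω)) :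
    MemLp f 2 (volume.restrict (Icc (0 : ℝ) ω)) := by
  obtain ⟨C, hC⟩ := isCompact_Icc.exists_bound_of_continuousOn hf
  refine MemLp.of_bound (hf.aestronglyMeasurable measurableSet_Icc) C ?_
  filter_upwards [ae_restrict_mem measurableSet_Icc] with s hs using hC s hs

/-- Integration by parts against a character, by Fubini's theorem. -/
lemma freq_smul_integral_primitive (hω : 0 < ω) (g : L2 ω H) (n : ℤ) :
    freq (2 * Real.pi / ω) n •
        ∫ s in Icc (0 : ℝ) ω, expNeg ω n s • ∫ r in (0 : ℝ)..s, g r =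
      (∫ r in Icc (0 : ℝ) ω, expNeg ω n r • g r) - ∫ r in Icc (0 : ℝ) ω, g r := by
  set μ := volume.restrict (Icc (0 : ℝ) ω) with hμ
  have hprod : Integrable (fun p : ℝ × ℝ => expNeg ω n p.1 • g p.2) (μ.prod μ) := by
    refine Integrable.smul_prod ?_ (L2.integrable g)
    exact ((continuous_expNeg ω n).integrableOn_Icc)
  have hS : MeasurableSet {p : ℝ × ℝ | p.2 ≤ p.1} :=
    measurableSet_le measurable_snd measurable_fst
  have hswap := integral_integral_swap (μ := μ) (ν := μ)
    (f := fun s r => indicator {p : ℝ × ℝ | p.2 ≤ p.1}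
      (fun p : ℝ × ℝ => expNeg ω n p.1 • g p.2) (s, r)) (hprod.indicator hS)
  have hl : ∫ s, expNeg ω n s • (∫ r in (0 : ℝ)..s, g r) ∂μ = ∫ s, ∫ r,
      indicator {p : ℝ × ℝ | p.2 ≤ p.1}
        (fun p : ℝ × ℝ => expNeg ω n p.1 • g p.2) (s, r) ∂μ ∂μ := by
    refine integral_congr_ae ?_
    filter_upwards [ae_restrict_mem measurableSet_Icc] with s hs
    have h1 : ∀ r, indicator {p : ℝ × ℝ | p.2 ≤ p.1}
        (fun p : ℝ × ℝ => expNeg ω n p.1 • g p.2) (s, r) =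
        expNeg ω n s • indicator (Iic s) g r := by
      intro r
      by_cases h : r ≤ s <;> simp [indicator, h]
    simp only [h1]
    rw [integral_smul, integral_indicator measurableSet_Iic, hμ,
      Measure.restrict_restrict measurableSet_Iic, intervalIntegral.integral_of_le hs.1,
      ← integral_Icc_eq_integral_Ioc]
    congr 4
    ext r
    simp only [mem_inter_iff, mem_Iic, mem_Icc]
    exact ⟨fun h => ⟨h.2, h.1, h.2.trans hs.2⟩, fun h => ⟨h.2.1, h.1⟩⟩
  -- After the swap the inner integral runs over `[r, ω]`; periodicity turns the endpoint value at
  -- `ω` into `1`.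
  have hr : ∀ r ∈ Icc (0 : ℝ) ω, freq (2 * Real.pi / ω) n • ∫ s,
      indicator {p : ℝ × ℝ | p.2 ≤ p.1}
        (fun p : ℝ × ℝ => expNeg ω n p.1 • g p.2) (s, r) ∂μ = expNeg ω n r • g r - g r := by
    intro r hr
    have h1 : ∀ s, indicator {p : ℝ × ℝ | p.2 ≤ p.1}
        (fun p : ℝ × ℝ => expNeg ω n p.1 • g p.2) (s, r) =
        indicator (Ici r) (expNeg ω n) s • g r := by
      intro s
      by_cases h : r ≤ s <;> simp [indicator, h]
    simp only [h1]
    rw [integral_smul_const, integral_indicator measurableSet_Ici, hμ,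
      Measure.restrict_restrict measurableSet_Ici]
    have h2 : Ici r ∩ Icc 0 ω = Icc r ω := by
      ext s
      simp only [mem_inter_iff, mem_Ici, mem_Icc]
      exact ⟨fun h => ⟨h.1, h.2.2⟩, fun h => ⟨h.1, hr.1.trans h.1, h.2⟩⟩
    rw [h2, integral_Icc_eq_integral_Ioc, ← intervalIntegral.integral_of_le hr.2, smul_smul,
      freq_mul_integral_expNeg, expNeg_period hω, sub_smul, one_smul]
  rw [hl, hswap, ← integral_smul, ← integral_sub (integrable_expNeg_smul (Lp.memLp g) n)
    (L2.integrable g)]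
  refine integral_congr_ae ?_
  filter_upwards [ae_restrict_mem measurableSet_Icc] with r h using hr r h

/-- The Fourier coefficients of the derivative. -/
lemma IsSobolevRep.freq_smul_coeff (hω : 0 < ω) {y g : L2 ω H} {Y : ℝ → H}
    (h : IsSobolevRep ω y Y g) (n : ℤ) :
    freq (2 * Real.pi / ω) n • coeff ω n Y =
      coeff ω n g - (ω : ℂ)⁻¹ • (Y ω - Y 0) := by
  have hsplit : ∫ s in Icc (0 : ℝ) ω, expNeg ω n s • Y s =
      (∫ s in Icc (0 : ℝ) ω, expNeg ω n s) • Y 0 +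
        ∫ s in Icc (0 : ℝ) ω, expNeg ω n s • ∫ r in (0 : ℝ)..s, g r := by
    have hc : ContinuousOn (fun s => Y s - Y 0) (Icc 0 ω) :=
      (h.continuousOn hω).sub continuousOn_const
    have h1 : ∫ s in Icc (0 : ℝ) ω, expNeg ω n s • ∫ r in (0 : ℝ)..s, g r =
        ∫ s in Icc (0 : ℝ) ω, expNeg ω n s • (Y s - Y 0) := by
      refine setIntegral_congr_fun measurableSet_Icc fun s hs => ?_
      simp only [h.2 s hs, add_sub_cancel_left]
    rw [h1, ← integral_smul_const, ← integral_add
      (integrable_expNeg_smul (memLp_const (Y 0)) n)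
      (integrable_expNeg_smul (memLp_of_continuousOn hc) n)]
    simp only [← smul_add, add_sub_cancel]
  have hint : ∫ r in Icc (0 : ℝ) ω, g r = Y ω - Y 0 := by
    rw [setIntegral_Icc_eq hω, h.2 ω (right_mem_Icc.2 hω.le), add_sub_cancel_left]
  have h0 : freq (2 * Real.pi / ω) n * ∫ s in Icc (0 : ℝ) ω, expNeg ω n s = 0 := by
    rw [setIntegral_Icc_eq hω, freq_mul_integral_expNeg, expNeg_at_zero, expNeg_period hω, sub_self]
  rw [coeff, coeff, smul_comm, hsplit, smul_add, smul_smul, h0, zero_smul, zero_add,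
    freq_smul_integral_primitive hω, hint, smul_sub]

/-- The coefficients of an element of the domain are summable. -/
lemma summable_norm_of_summable_freq {b : ℝ} (hb : b ≠ 0) {x : Seq2 H}
    (h : Summable fun n => ‖freq b n • x n‖ ^ 2) : Summable fun n => ‖x n‖ := by
  have h1 : Summable fun n => ‖(freq b n - 1) • x n‖ ^ 2 := by
    have h2 := memℓp_two_iff.1 ((memℓp_two_iff.2 h).sub (lp.memℓp x))
    refine h2.congr fun n => ?_
    rw [Pi.sub_apply, sub_smul, one_smul]
  -- Cauchy–Schwarz: `(A - 1)x` is in `ℓ²`, and so is the sequence of norms of `(ibn - 1)⁻¹`.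
  have h3 := summable_mul_of_sq (f := fun n => ‖freq b n - 1‖⁻¹) (fun _ => by positivity)
    (fun _ => norm_nonneg _)
    (by simpa only [inv_pow] using summable_sq_inv_freq_sub_one hb) h1
  refine h3.congr fun n => ?_
  rw [norm_smul, inv_mul_cancel_left₀ (norm_ne_zero_iff.2 (freq_sub_one_ne_zero b n))]

/-- A continuous function with summable Fourier coefficients is the sum of its Fourier series. -/
lemma eqOn_fourierSeries (hω : 0 < ω) {Y : ℝ → H} (hY : ContinuousOn Y (Icc 0 ω))
    (hs : Summable fun n => ‖coeff ω n Y‖) :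
    EqOn Y (fun s => ∑' n, expNeg ω (-n) s • coeff ω n Y) (Icc 0 ω) := by
  have hω' : (ω : ℂ) ≠ 0 := by exact_mod_cast hω.ne'
  set x : ℤ → H := fun n => coeff ω n Y
  have hnorm : ∀ m n s, ‖expNeg ω m s • x n‖ = ‖x n‖ := fun m n s => by
    rw [norm_smul, norm_expNeg, one_mul]
  have hc : Continuous fun s => ∑' n, expNeg ω (-n) s • x n :=
    continuous_tsum (fun n => (continuous_expNeg ω (-n)).smul continuous_const) hs
      fun n s => (hnorm _ _ _).le
  refine Measure.eqOn_Icc_of_ae_eq volume hω.ne ?_ hY hc.continuousOn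
  refine ae_eq_of_coeff_eq hω (memLp_of_continuousOn hY) (memLp_of_continuousOn hc.continuousOn)
    fun m => ?_
  have h1 := hasSum_integral_of_summable_integral_norm
    (F := fun n s => expNeg ω m s • expNeg ω (-n) s • x n)
    (μ := volume.restrict (Icc (0 : ℝ) ω))
    (fun n => integrable_expNeg_smul (memLp_expNeg_smul ω (-n) (x n)) m) (by
      simp only [norm_smul, norm_expNeg, one_mul, integral_const]
      exact hs.mul_left _)
  have h2 : ∀ n, ∫ s in Icc (0 : ℝ) ω, expNeg ω m s • expNeg ω (-n) s • x n =
      if n = m then (ω : ℂ) • x m else 0 := by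
    intro n
    simp only [smul_smul, ← expNeg_add]
    rw [integral_smul_const, integral_expNeg hω]
    by_cases h : n = m
    · rw [if_pos (by omega), if_pos h, h]
    · rw [if_neg (by omega), if_neg h, zero_smul]
  simp only [h2] at h1
  have h3 := h1.unique (hasSum_ite_eq m _)
  have h4 : ∀ s, ∑' n, expNeg ω m s • expNeg ω (-n) s • x n =
      expNeg ω m s • ∑' n, expNeg ω (-n) s • x n := fun s => tsum_const_smul'' _
  simp only [h4] at h3
  change coeff ω m Y = (ω : ℂ)⁻¹ • ∫ s in Icc (0 : ℝ) ω, expNeg ω m s • ∑' n, expNeg ω (-n) s • x n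
  rw [h3, inv_smul_smul₀ hω']

/-- The bound comes from boundedness of `potentialMap` and Hölder on a finite interval. Being
uniform in `x`, it permits termwise integration of `V` against a Fourier series without assuming
that `‖V s‖` is integrable. -/
lemma exists_integral_norm_potential_le {V : ℝ → H →L[ℂ] H} (hV : IsStronglyL2 ω V) :
    ∃ C, ∀ x, ∫ s in Icc (0 : ℝ) ω, ‖V s x‖ ≤ C * ‖x‖ := by
  set μ := volume.restrict (Icc (0 : ℝ) ω)
  set K : ℝ≥0∞ := μ univ ^ (1 / (1 : ℝ≥0∞).toReal - 1 / (2 : ℝ≥0∞).toReal)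
  have hK : K ≠ ∞ := ENNReal.rpow_ne_top_of_nonneg (by norm_num) (measure_ne_top _ _)
  refine ⟨K.toReal * ‖potentialMap hV‖, fun x => ?_⟩
  have h3 := eLpNorm_le_eLpNorm_mul_rpow_measure_univ (p := 1) (q := 2) (by norm_num) (hV x).1
  have h4 : eLpNorm (fun s => V s x) 2 μ = ‖potentialMap hV x‖ₑ := (Lp.enorm_toLp (hV x)).symm
  rw [h4, eLpNorm_one_eq_lintegral_enorm] at h3
  rw [integral_norm_eq_lintegral_enorm (hV x).1]
  have h5 := ENNReal.toReal_mono (ENNReal.mul_ne_top enorm_ne_top hK) h3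
  rw [ENNReal.toReal_mul, toReal_enorm] at h5
  calc _ ≤ _ := h5
    _ ≤ (‖potentialMap hV‖ * ‖x‖) * K.toReal := by
      gcongr
      exact (potentialMap hV).le_opNorm x
    _ = _ := by ring

/-- The Fourier coefficients of `s ↦ V(s) Y(ω - s)`. -/
lemma coeff_potential (hω : 0 < ω) {V : ℝ → H →L[ℂ] H} (hV : IsStronglyL2 ω V) {Y : ℝ → H}
    (hY : ContinuousOn Y (Icc 0 ω)) (hs : Summable fun n => ‖coeff ω n Y‖) (j : ℤ) :
    coeff ω j (fun s => V s (Y (ω - s))) = ∑' n, fourierCoeffV hV (j + n) (coeff ω n Y) := by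
  set x : ℤ → H := fun n => coeff ω n Y with hx
  obtain ⟨C, hC⟩ := exists_integral_norm_potential_le hV
  have h1 := hasSum_integral_of_summable_integral_norm
    (F := fun n s => expNeg ω (j + n) s • V s (x n))
    (μ := volume.restrict (Icc (0 : ℝ) ω))
    (fun n => integrable_expNeg_smul (hV (x n)) (j + n)) (by
      simp only [norm_smul, norm_expNeg, one_mul]
      exact (hs.mul_left C).of_nonneg_of_le (fun n => integral_nonneg fun s => norm_nonneg _)
        fun n => hC (x n))
  have h2 : ∫ s in Icc (0 : ℝ) ω, expNeg ω j s • V s (Y (ω - s)) =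
      ∫ s in Icc (0 : ℝ) ω, ∑' n, expNeg ω (j + n) s • V s (x n) := by
    refine setIntegral_congr_fun measurableSet_Icc fun s hsI => ?_
    have h3 := eqOn_fourierSeries hω hY hs (show ω - s ∈ Icc 0 ω from
      ⟨by linarith [hsI.2], by linarith [hsI.1]⟩)
    simp only [expNeg_reflect hω] at h3
    have h4 : Summable fun n => expNeg ω n s • x n := by
      refine Summable.of_norm ?_
      simpa only [norm_smul, norm_expNeg, one_mul] using hs
    simp only [h3]
    rw [(V s).map_tsum h4, ← tsum_const_smul'']
    refine tsum_congr fun n => ?_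
    rw [map_smul, smul_smul, ← expNeg_add]
  rw [coeff, h2, ← h1.tsum_eq, ← tsum_const_smul'']
  rfl

/-- The Fourier transform turns `L` into the model operator. -/
lemma mem_operatorGraph_iff (hω : 0 < ω) {V : ℝ → H →L[ℂ] H} (hV : IsStronglyL2 ω V)
    {U : L2 ω H ≃L[ℂ] Seq2 H} (hU : ∀ y n, U y n = coeff ω n y) (y z : L2 ω H) :
    (y, z) ∈ operatorGraph ω V ↔
      IsModelImage (2 * Real.pi / ω) (fourierCoeffV hV) (U y) (U z) := by
  have hω' : (ω : ℂ) ≠ 0 := by exact_mod_cast hω.ne'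
  have hb := two_pi_div_ne_zero hω
  have key : ∀ {Y : ℝ → H} {g : L2 ω H}, IsSobolevRep ω y Y g → Y 0 = Y ω →
      (∀ n, coeff ω n g = freq (2 * Real.pi / ω) n • U y n) ∧
      (Summable fun n => ‖freq (2 * Real.pi / ω) n • U y n‖ ^ 2) ∧
      ∀ j, coeff ω j (fun s => g s - V s (Y (ω - s))) =
        freq (2 * Real.pi / ω) j • U y j - ∑' n, fourierCoeffV hV (j + n) (U y n) := by
    intro Y g h hY
    have hyY : ∀ n, U y n = coeff ω n Y := fun n => (hU y n).trans (coeff_congr n h.1)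
    have hg : ∀ n, coeff ω n g = freq (2 * Real.pi / ω) n • U y n := fun n => by
      rw [hyY, h.freq_smul_coeff hω, hY, sub_self, smul_zero, sub_zero]
    have hsq : Summable fun n => ‖freq (2 * Real.pi / ω) n • U y n‖ ^ 2 := by
      simpa only [← hg, ← hU] using (U g).summable
    refine ⟨hg, hsq, fun j => ?_⟩
    have hs := summable_norm_of_summable_freq hb hsq
    simp only [hyY] at hs
    rw [coeff_sub j (Lp.memLp g) (memLp_potential hω hV h), hg,
      coeff_potential hω hV (h.continuousOn hω) hs]
    simp only [hyY]
  constructor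
  · rintro ⟨Y, g, h, hY, hz⟩
    obtain ⟨-, hsq, hc⟩ := key h hY
    refine ⟨hsq, fun j => ?_⟩
    rw [← hc, hU]
    exact coeff_congr j hz
  · rintro ⟨hsq, hz⟩
    set w : Seq2 H := ⟨_, memℓp_two_iff.2 hsq⟩
    have hw : ∀ n, w n = freq (2 * Real.pi / ω) n • U y n := fun n => rfl
    set g := U.symm w
    have hg : ∀ n, coeff ω n g = freq (2 * Real.pi / ω) n • U y n := fun n => by
      rw [← hU, U.apply_symm_apply, hw]
    have hprim : ContinuousOn (fun s => ∫ r in (0 : ℝ)..s, g r) (Icc 0 ω) := by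
      refine (intervalIntegral.continuousOn_primitive_interval (b := ω) ?_).mono Icc_subset_uIcc
      rw [uIcc_of_le hω.le]
      exact L2.integrable g
    -- The eigenvalue at `n = 0` vanishes, so the derivative does not determine the mean of `y`;
    -- this constant restores it.
    set c := coeff ω 0 y - coeff ω 0 fun s => ∫ r in (0 : ℝ)..s, g r with hcdef
    set Y : ℝ → H := fun s => c + ∫ r in (0 : ℝ)..s, g r with hYdef
    have hYm : MemLp Y 2 (volume.restrict (Icc (0 : ℝ) ω)) :=
      memLp_of_continuousOn (continuousOn_const.add hprim)
    have hYeq : ∀ s, Y s = Y 0 + ∫ r in (0 : ℝ)..s, g r := fun s => by simp [hYdef]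
    -- For the same reason `g` has mean zero, which is the periodicity of its primitive.
    have hg0 : ∫ r in (0 : ℝ)..ω, g r = 0 := by
      have h1 := hg 0
      rw [freq_zero, zero_smul, coeff] at h1
      simp only [expNeg_zero, one_smul] at h1
      rw [← setIntegral_Icc_eq hω]
      exact (smul_eq_zero.1 h1).resolve_left (inv_ne_zero hω')
    have hY0 : Y 0 = Y ω := by rw [hYeq ω, hg0, add_zero]
    have hrep : IsSobolevRep ω (hYm.toLp Y) Y g := ⟨hYm.coeFn_toLp, fun s _ => hYeq s⟩
    have hyY : y =ᵐ[volume.restrict (Icc (0 : ℝ) ω)] Y := by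
      refine ae_eq_of_coeff_eq hω (Lp.memLp y) hYm fun n => ?_
      by_cases hn : n = 0
      · subst hn
        rw [hYdef, coeff_add 0 (memLp_const c) (memLp_of_continuousOn hprim), coeff_const hω,
          hcdef, sub_add_cancel]
      · refine smul_right_injective H (freq_ne_zero hb hn) ?_
        simp only
        rw [hrep.freq_smul_coeff hω, hY0, sub_self, smul_zero, sub_zero, hg, hU]
    have hrep' : IsSobolevRep ω y Y g := ⟨hyY, hrep.2⟩
    obtain ⟨-, -, hc⟩ := key hrep' hY0
    refine ⟨Y, g, hrep', hY0, ?_⟩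
    refine ae_eq_of_coeff_eq hω (Lp.memLp z)
      ((Lp.memLp g).sub (memLp_potential hω hV hrep')) fun j => ?_
    refine ((hU z j).symm.trans (hz j)).trans ?_
    exact (hc j).symm

end SobolevCoefficients

/-- `L` generates a strongly continuous group. -/
theorem exists_group_operatorL {H : Type*} [NormedAddCommGroup H] [InnerProductSpace ℂ H]
    [CompleteSpace H] {ω : ℝ} (hω : 0 < ω) {V : ℝ → H →L[ℂ] H} (hV : IsStronglyL2 ω V)
    (hV₁ : SquareSummableCoeff hV) (hV₂ : SquareSummableHankel hV) :
    ∃ T : ℝ → L2 ω H →L[ℂ] L2 ω H, IsC0Group T ∧ IsGenerator (operatorL ω V) T := by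
  obtain ⟨U, hU⟩ := exists_fourierEquiv (H := H) hω
  obtain ⟨T, hT, hgen⟩ := exists_modelGroup hV₁ (two_pi_div_ne_zero hω) hV₂
  refine ⟨_, hT.conj U, fun y z => ?_⟩
  rw [graph_operatorL hω, mem_operatorGraph_iff hω hV hU, ← hgen]
  exact (hasOrbitDeriv_conj U y z).symm

end InvolutionProblem

theorem theorem2p2 {H : Type*} [NormedAddCommGroup H] [InnerProductSpace ℂ H] [CompleteSpace H]
    {ω : ℝ} (hω : 0 < ω) (V : ℝ → H →L[ℂ] H)
    (hV : InvolutionProblem.IsStronglyL2 ω V)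
    (hV₁ : InvolutionProblem.SquareSummableCoeff hV)
    (hV₂ : InvolutionProblem.SquareSummableHankel hV) :
    ∃ T : ℝ → InvolutionProblem.L2 ω H →L[ℂ] InvolutionProblem.L2 ω H,
      InvolutionProblem.IsC0Group T ∧
      InvolutionProblem.IsGenerator (InvolutionProblem.operatorL ω V) T ∧
      (∀ S : ℝ → InvolutionProblem.L2 ω H →L[ℂ] InvolutionProblem.L2 ω H,
        InvolutionProblem.IsC0Group S →
        InvolutionProblem.IsGenerator (InvolutionProblem.operatorL ω V) S → S = T) ∧
      ∀ J : Set ℝ, InvolutionProblem.IsTimeInterval J → (0 : ℝ) ∈ J →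
      ∀ (φ : InvolutionProblem.L2 ω H) (f : ℝ → InvolutionProblem.L2 ω H), ContinuousOn f J →
        ∃ u : ℝ → InvolutionProblem.L2 ω H,
          InvolutionProblem.IsMildSolution (InvolutionProblem.operatorL ω V) J φ f u ∧
          (∀ v : ℝ → InvolutionProblem.L2 ω H,
            InvolutionProblem.IsMildSolution (InvolutionProblem.operatorL ω V) J φ f v →
            EqOn v u J) ∧
          ∀ t ∈ J, u t = T t φ + ∫ τ in (0 : ℝ)..t, T (t - τ) (f τ) := by
  obtain ⟨T, hT, hgen⟩ := InvolutionProblem.exists_group_operatorL hω hV hV₁ hV₂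
  exact ⟨T, hT, hgen, fun S hS hgenS => hgen.group_unique hT hS hgenS,
    fun J hJ h0 φ f hf => hgen.existsUnique_mild hT hJ h0 φ hf⟩
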